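/- Let $\mathbb K$ be an algebraically closed field and let $u_0,u_1,u_2\in R:=\mathbb K[T_0,T_1]$ be homogeneous polynomials of the same degree $d\ge 1$ without common factors, such that the map $\phi:\mathbb P^1\to\mathbb P^2$, $t\mapsto(u_0(t):u_1(t):u_2(t))$, is birational onto its image, the plane curve $C$. Let $\mathcal E_d\in\mathbb K[X_0,X_1,X_2]$ be an irreducible form whose zero set is $C$ (it is unique up to a nonzero constant and has degree $d$). Let $I=\langle u_0,u_1,u_2\rangle$, and let $\mathcal K$ be the kernel of the $R$-algebra map $R[X_0,X_1,X_2]\to\mathrm{Rees}(I)=\bigoplus_{n\ge0}I^nZ^n$, $X_i\mapsto u_iZ$; it is a bihomogeneous ideal, and $\mathcal K_{i,j}$ denotes its piece of degree $i$ in $\underline T=(T_0,T_1)$ and $j$ in $\underline X=(X_0,X_1,X_2)$. Let $\{P_{\mu,1},Q_{d-\mu,1}\}$ be a $\mu$-basis: homogeneous elements, of $\underline T$-degrees $\mu\le d-\mu$, of $\mathcal K_{*,1}\cong\mathrm{Syz}(u_0,u_1,u_2)$ which form a basis of this $R$-module. Assume that $\mu<d-\mu$ and that $C$ has a very singular point,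 i.e. a point of multiplicity greater than $\mu$, which we take to be $(0:0:1)$. Write $d=k\mu+r$ with $k\in\mathbb N$ and either $-1\le r<\mu-1$, or $\mu=1$ and $r=0$ (so $\mu\ge1$; for $\mu=1$ both $k=d+1$ and $k=d$ are allowed). Then $P_{\mu,1}=p^1X_0-p^0X_1$ with $p^0,p^1\in R$ forms of degree $\mu$. For $G$ bihomogeneous of bidegree $(i,j)$ with $i\ge2\mu-1$, write $G=p^0G^0+p^1G^1$ with $G^0,G^1$ bihomogeneous of bidegree $(i-\mu,j)$ and set $\mathcal D_T(G):=X_0G^0+X_1G^1$ (this depends on the chosen decomposition). Put $F_{\mu,1}:=P_{\mu,1}$, $F_{(k-1)\mu+r,1}:=Q_{d-\mu,1}$, and for $j=2,\dots,k-1$ let recursively $F_{(k-j)\mu+r,j}:=\mathcal D_T\big(F_{(k-j+1)\mu+r,j-1}\big)$, with any choice of the decompositions. Such a sequence exists (the required decompositions can always be made), and for every such sequence: 1. For each $j=1,\dots,k-1$, $F_{(k-j)\mu+r,j}\in\mathcal K_{(k-j)\mu+r,j}$ and it is not a multiple of $F_{\mu,1}$; in particular it is not zero. 2. For each $j=1,\dots,k-1$,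 up to a nonzero constant in $\mathbb K$, $\mathrm{Res}_{\underline T}\big(F_{\mu,1},F_{(k-j)\mu+r,j}\big)=\mathcal E_d(\underline X)$, where $\mathrm{Res}_{\underline T}$ is the resultant of binary forms in $\underline T$ of degrees $\mu$ and $(k-j)\mu+r$. 3. If $G\in\mathcal K_{i,j}$ with $i+\mu j<d$, then $G$ is a multiple of $F_{\mu,1}$. 4. Suppose, in case $\mu=1$, that $k=d$ (that is, $r=0$). Then the elements $\mathcal E_d,\ F_{\mu,1},\ F_{\mu+r,k-1},\ F_{2\mu+r,k-2},\ \dots,\ F_{d-\mu,1}$ are $k+1$ distinct elements, and the set of them is contained in a minimal system of generators of $\mathcal K$, i.e. in a finite set of bihomogeneous generators of $\mathcal K$ none of which can be omitted. -/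

import Mathlib

namespace ReesCurve

open MvPolynomial
open scoped LinearAlgebra.Projectivization

noncomputable section

/-- `R = K[T₀, T₁]`. -/
abbrev RingT (K : Type*) [Field K] := MvPolynomial (Fin 2) K

/-- `K[X₀, X₁, X₂]`. -/
abbrev RingX (K : Type*) [Field K] := MvPolynomial (Fin 3) K

/-- `K[T₀, T₁][X₀, X₁, X₂]`. -/
abbrev RingTX (K : Type*) [Field K] := MvPolynomial (Fin 3) (RingT K)

variable {K : Type*} [Field K]

/-- `P` is bihomogeneous of degree `i` in `T₀, T₁` and of degree `j` in `X₀, X₁, X₂`. -/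
def IsBihomogeneous (P : RingTX K) (i j : ℕ) : Prop :=
  P.IsHomogeneous j ∧ ∀ m, (P.coeff m).IsHomogeneous i

/-- The inclusion `K[X] → K[T][X]`. -/
def inclX : RingX K →+* RingTX K := MvPolynomial.map (C : K →+* RingT K)

/-- The ideal `I = ⟨u₀, u₁, u₂⟩` of `K[T]`. -/
def paramIdeal (u : Fin 3 → RingT K) : Ideal (RingT K) := Ideal.span (Set.range u)

lemma monomial_mem_rees (u : Fin 3 → RingT K) (i : Fin 3) :
    Polynomial.monomial 1 (u i) ∈ reesAlgebra (paramIdeal u) := by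
  rw [reesAlgebra.monomial_mem, pow_one]
  exact Ideal.subset_span ⟨i, rfl⟩

/-- The `K[T]`-algebra map `Φ : K[T][X] → Rees(I) = ⨁ Iⁿ Zⁿ`, `Xᵢ ↦ uᵢ Z`. -/
def reesMap (u : Fin 3 → RingT K) : RingTX K →ₐ[RingT K] reesAlgebra (paramIdeal u) :=
  aeval fun i => ⟨Polynomial.monomial 1 (u i), monomial_mem_rees u i⟩

/-- The defining ideal `𝒦 = ker Φ` of the Rees algebra of `I`. -/
def reesIdeal (u : Fin 3 → RingT K) : Ideal (RingTX K) := RingHom.ker (reesMap u)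

/-- `G` lies in the bigraded piece `𝒦_{i,j}` (which contains `0`). -/
def MemReesPiece (u : Fin 3 → RingT K) (i j : ℕ) (G : RingTX K) : Prop :=
  G ∈ reesIdeal u ∧ IsBihomogeneous G i j

/-- The curve `C ⊆ ℙ²`: the image of `φ : ℙ¹ → ℙ²`, `t ↦ (u₀(t) : u₁(t) : u₂(t))`. -/
def curve (u : Fin 3 → RingT K) : Set (ℙ K (Fin 3 → K)) :=
  {x | ∃ t : Fin 2 → K, t ≠ 0 ∧
    ∃ h : (fun i => eval t (u i)) ≠ 0, x = Projectivization.mk K (fun i => eval t (u i)) h}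

/-- `E` is an irreducible form whose zero set in `ℙ²` is the curve `C`. -/
structure IsImplicitEquation (u : Fin 3 → RingT K) (E : RingX K) : Prop where
  irreducible : Irreducible E
  homogeneous : ∃ n, E.IsHomogeneous n
  zeros : ∀ (x : Fin 3 → K) (hx : x ≠ 0), Projectivization.mk K x hx ∈ curve u ↔ eval x E = 0

/-- `φ` is proper, i.e. birational onto its image: there is a rational map `ψ = (A : B)` to `ℙ¹`,
given by forms `A, B` of the same degree not both vanishing on the curve, with `ψ ∘ φ = id`. -/
def IsProper (u : Fin 3 → RingT K) : Prop :=
  ∃ (l : ℕ) (A B : RingX K), A.IsHomogeneous l ∧ B.IsHomogeneous l ∧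
    ¬ (aeval u A = 0 ∧ aeval u B = 0) ∧ X 1 * aeval u A = X 0 * aeval u B

/-- The multiplicity at the point of homogeneous coordinates `v` of the plane curve given by the
form `E`: the order at `0` of `E(v + Y)`. -/
def multAt (E : RingX K) (v : Fin 3 → K) : ℕ∞ :=
  ((aeval (fun i => (X i + C (v i) : RingX K)) E : RingX K) : MvPowerSeries (Fin 3) K).order

/-- The syzygy module of `(u₀, u₁, u₂)`. -/
def syz (u : Fin 3 → RingT K) : Submodule (RingT K) (Fin 3 → RingT K) :=
  LinearMap.ker (Fintype.linearCombination (RingT K) u)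

/-- `(p, q)` is a `μ`-basis: a basis of the syzygy module, homogeneous of degrees `μ` and `d - μ`,
where `μ ≤ d - μ`. -/
structure IsMuBasis (u : Fin 3 → RingT K) (d μ : ℕ) (p q : Fin 3 → RingT K) : Prop where
  le : 2 * μ ≤ d
  homogeneous_left : ∀ i, (p i).IsHomogeneous μ
  homogeneous_right : ∀ i, (q i).IsHomogeneous (d - μ)
  linearIndependent : LinearIndependent (RingT K) ![p, q]
  span_eq : Submodule.span (RingT K) {p, q} = syz u

/-- The element `a₀ X₀ + a₁ X₁ + a₂ X₂` of `K[T][X]` attached to the syzygy `a`. -/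
def toForm (a : Fin 3 → RingT K) : RingTX K := ∑ i, C (a i) * X i

/-- `H` is a value of `𝒟_T(G)`, for `G` bihomogeneous of bidegree `(i, j)` with `i ≥ 2μ - 1`, with
respect to forms `p⁰, p¹` of degree `μ`: for some decomposition `G = p⁰ G⁰ + p¹ G¹` with `G⁰, G¹`
bihomogeneous of bidegree `(i - μ, j)`, one has `H = X₀ G⁰ + X₁ G¹`. -/
def IsDT (μ : ℕ) (p0 p1 : RingT K) (i j : ℕ) (G H : RingTX K) : Prop :=
  2 * μ ≤ i + 1 ∧ IsBihomogeneous G i j ∧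
    ∃ G0 G1 : RingTX K, IsBihomogeneous G0 (i - μ) j ∧ IsBihomogeneous G1 (i - μ) j ∧
      G = C p0 * G0 + C p1 * G1 ∧ H = X 0 * G0 + X 1 * G1

/-- `F j`, for `1 ≤ j ≤ k - 1`, is a possible choice of the elements `F_{(k-j)μ+r, j}`, where
`d = kμ + r`, so that `(k - j)μ + r = d - jμ`: `F 1` is the form of the second element `q` of the
`μ`-basis, and `F j = 𝒟_T (F (j-1))` for `2 ≤ j ≤ k - 1`. Here `𝒟_T` is taken with respect to
`p⁰ = -p₁` and `p¹ = p₀`, where `p₀ X₀ + p₁ X₁` is the form of the first element of the basis. -/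
def IsFamily (d μ k : ℕ) (p q : Fin 3 → RingT K) (F : ℕ → RingTX K) : Prop :=
  F 1 = toForm q ∧
    ∀ j, 2 ≤ j → j ≤ k - 1 → IsDT μ (-p 1) (p 0) (d - (j - 1) * μ) (j - 1) (F (j - 1)) (F j)

/-- The substitution `T₀ ↦ Y`, `T₁ ↦ 1`, from `K[T][X]` to `K[X][Y]`. -/
def dehomT : RingTX K →+* Polynomial (RingX K) :=
  eval₂Hom (aeval ![(Polynomial.X : Polynomial (RingX K)), 1] :
    RingT K →ₐ[K] Polynomial (RingX K)).toRingHom fun i => Polynomial.C (X i)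

/-- The resultant with respect to `T₀, T₁` of `F` and `G`, considered as binary forms in `T₀, T₁`
of degrees `m` and `n` with coefficients in `K[X]`: the determinant of their Sylvester matrix. -/
def resT (F G : RingTX K) (m n : ℕ) : RingX K :=
  Polynomial.resultant (dehomT F) (dehomT G) m n

/-- `S` is a minimal system of generators of the bigraded ideal `J`: a finite set of bihomogeneous
generators, none of which can be omitted. -/
structure IsMinimalGenerators (J : Ideal (RingTX K)) (S : Set (RingTX K)) : Prop where
  finite : S.Finite
  bihomogeneous : ∀ s ∈ S, ∃ i j, IsBihomogeneous s i j
  span_eq : Ideal.span S = J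
  irredundant : ∀ s ∈ S, s ∉ Ideal.span (S \ {s})

end

end ReesCurve

/-! Write P and Q for the forms of `p` and `q`, with p⁰ = `-p 1` and p¹ = `p 0`.

The very singular point forces P to be free of X₂. Projection of C from (0 : 0 : 1) is the function
f = u₀/u₁ (when u₁ ≠ 0). Since φ is birational, K(T) = K(f)(u₂/u₁), so f has degree at most deg_{X₂}
E, hence at most deg E minus the multiplicity of the point. Clearing denominators gives a syzygy of
degree less than d - μ with last entry zero. Such a syzygy is a multiple of `p`, so `p 2 = 0`
(`IsMuBasis.left_two_eq_zero`). By Hilbert–Burch and the Nullstellensatz, Res(P, Q) is a power of E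
up to a constant; comparing degrees in X₂ shows that the exponent is one, whence deg E = d.

Now u₀ = g p⁰ and u₁ = g p¹, where g is a constant times `q 2`. The main tool is θ = `theta p`, that
is X₀ ↦ p⁰, X₁ ↦ p¹, X₂ ↦ Y, with three properties. (a) A form in X killed by θ is a multiple of P
(`dvd_of_theta_eq_zero`). (b) θ(X₀G⁰ + X₁G¹) = θ(p⁰G⁰ + p¹G¹), so 𝒟_T does not change θ and θ(F_j) =
θ(Q) ≠ 0. (c) If G is in 𝒦, then θ(G) has the root u₂/g, whose denominator is divisible by `q 2`. By
the rational root theorem `q 2` divides its leading coefficient, and counting degrees in T gives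
θ(G) = 0 as soon as i + μj < d (`theta_eq_zero_of_lt`). Assertion 3 is (a) with (c); that F_j is not
a multiple of P is (b).

The congruence p⁰ 𝒟_T(G) ≡ X₀ G modulo P carries membership in 𝒦 from F_{j-1} to F_j, and shows that
away from X₀ = 0 a common zero of P and F_j is one of P and Q. So Res(P, F_j) is nonzero; it is
divisible by E and has degree d.

For minimality, an element of 𝒦 cannot be replaced when it is not generated by elements of 𝒦 of
smaller bidegree. The bidegree of F_j lies on the line i + μj = d, below which θ vanishes on 𝒦,
while θ(F_j) ≠ 0. -/

namespace ReesCurve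
open MvPolynomial
open scoped LinearAlgebra.Projectivization
noncomputable section
variable {K : Type*} [Field K]

/-! ### Binary forms, resultants and their degrees -/

section

theorem eval₂_mul_of_isHomogeneous {σ R S : Type*} [CommSemiring R] [CommSemiring S] (f : R →+* S)
    {G : MvPolynomial σ R} {n : ℕ} (hG : G.IsHomogeneous n) (c : S) (x : σ → S) :
    eval₂ f (fun i => c * x i) G = c ^ n * eval₂ f x G := by
  rw [eval₂_eq, eval₂_eq, Finset.mul_sum]
  refine Finset.sum_congr rfl fun m hm => ?_
  simp only [mul_pow, Finset.prod_mul_distrib, Finset.prod_pow_eq_pow_sum]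
  rw [hG.degree_eq_sum_deg_support hm]
  ring

theorem aeval_mul_of_isHomogeneous {σ R S : Type*} [CommSemiring R] [CommSemiring S] [Algebra R S]
    {G : MvPolynomial σ R} {n : ℕ} (hG : G.IsHomogeneous n) (c : S) (x : σ → S) :
    aeval (fun i => c * x i) G = c ^ n * aeval x G :=
  eval₂_mul_of_isHomogeneous _ hG c x

theorem eval_mul_of_isHomogeneous {σ R : Type*} [CommSemiring R]
    {G : MvPolynomial σ R} {n : ℕ} (hG : G.IsHomogeneous n) (c : R) (x : σ → R) :
    eval (fun i => c * x i) G = c ^ n * eval x G :=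
  eval₂_mul_of_isHomogeneous _ hG c x

theorem eval_zero_of_isHomogeneous {σ R : Type*} [CommSemiring R]
    {G : MvPolynomial σ R} {n : ℕ} (hG : G.IsHomogeneous n) (hn : n ≠ 0) :
    eval 0 G = 0 := by
  have := eval_mul_of_isHomogeneous hG 0 0
  simpa [hn, ← Pi.zero_def] using this

/-- Dehomogenization of binary forms: `T₀ ↦ Y`, `T₁ ↦ 1`. -/
def dehom : RingT K →ₐ[K] Polynomial K := aeval ![Polynomial.X, 1]

@[simp] lemma dehom_X_zero : dehom (X 0 : RingT K) = Polynomial.X := by simp [dehom]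
@[simp] lemma dehom_X_one : dehom (X 1 : RingT K) = 1 := by simp [dehom]

theorem homogenize_dehom {a : RingT K} {n : ℕ} (ha : a.IsHomogeneous n) :
    (dehom a).homogenize n = a :=
  Polynomial.homogenize_eq_of_isHomogeneous ha rfl

theorem dehom_homogenize {f : Polynomial K} {n : ℕ} (hf : f.natDegree ≤ n) :
    dehom (f.homogenize n) = f :=
  Polynomial.aeval_homogenize_X_one f hf

theorem natDegree_dehom_le {a : RingT K} {n : ℕ} (ha : a.IsHomogeneous n) :
    (dehom a).natDegree ≤ n := by
  rw [dehom, aeval_def, eval₂_eq]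
  refine Polynomial.natDegree_sum_le_of_forall_le _ _ fun m hm => ?_
  have h := ha.degree_eq_sum_deg_support hm
  rw [Finset.prod_subset (Finset.subset_univ _) (by simp +contextual), Fin.prod_univ_two]
  rw [Finset.sum_subset (Finset.subset_univ _) (by simp +contextual), Fin.sum_univ_two] at h
  simp only [Matrix.cons_val_zero, Matrix.cons_val_one, one_pow, mul_one,
    Polynomial.algebraMap_eq]
  exact (Polynomial.natDegree_C_mul_X_pow_le _ _).trans (by omega)

theorem dehom_injective_of_isHomogeneous {a b : RingT K} {n : ℕ} (ha : a.IsHomogeneous n)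
    (hb : b.IsHomogeneous n) (h : dehom a = dehom b) : a = b := by
  rw [← homogenize_dehom ha, h, homogenize_dehom hb]

theorem eval_dehom (a : RingT K) (y : K) : (dehom a).eval y = eval ![y, 1] a := by
  have : (Polynomial.evalRingHom y).comp (dehom : RingT K →ₐ[K] Polynomial K).toRingHom
      = eval ![y, 1] := by
    ext i
    · simp
    · fin_cases i <;> simp
  exact congr($this a)

theorem coeff_dehom_self {a : RingT K} {n : ℕ} (ha : a.IsHomogeneous n) :
    (dehom a).coeff n = eval ![1, 0] a := by
  conv_rhs => rw [← homogenize_dehom ha]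
  rw [Polynomial.homogenize, map_sum, Finset.sum_eq_single (n, 0)]
  · simp [eval_monomial, Finsupp.prod_fintype]
  · rintro ⟨b, c⟩ hb hne
    have : c ≠ 0 := by rintro rfl; simp_all
    simp [eval_monomial, Finsupp.prod_fintype, this]
  · simp

theorem eval_eq_eval_dehom {a : RingT K} {n : ℕ} (ha : a.IsHomogeneous n) {t : Fin 2 → K}
    (ht : t 1 ≠ 0) : eval t a = (dehom a).eval (t 0 / t 1) * t 1 ^ n := by
  conv_lhs => rw [← homogenize_dehom ha]
  exact Polynomial.eval_homogenize (natDegree_dehom_le ha) t ht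

/-- The second alternative is a common root at infinity, which appears because `m` and `n` are
formal degrees. -/
theorem resultant_eq_zero_iff_exists_root [IsAlgClosed K] {f g : Polynomial K} {m n : ℕ}
    (hm : m ≠ 0) (hf : f.natDegree ≤ m) (hg : g.natDegree ≤ n) :
    Polynomial.resultant f g m n = 0 ↔
      (∃ y, f.eval y = 0 ∧ g.eval y = 0) ∨ (f.coeff m = 0 ∧ g.coeff n = 0) := by
  have key : ∀ (h : f ≠ 0 ∨ g ≠ 0),
      Polynomial.resultant f g = 0 ↔ ∃ y, f.eval y = 0 ∧ g.eval y = 0 := by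
    intro h
    rw [Polynomial.resultant_eq_zero_iff,
      Polynomial.isCoprime_iff_aeval_ne_zero_of_isAlgClosed K K]
    simp only [h, true_and, not_forall, not_or, not_not, Polynomial.coe_aeval_eq_eval]
  by_cases hfm : f.coeff m = 0
  · by_cases hgn : g.coeff n = 0
    · simp only [hfm, hgn, and_self, or_true, iff_true]
      have hf' : f.natDegree < m := by
        refine lt_of_le_of_ne hf fun h => hm ?_
        rw [← h, Polynomial.coeff_natDegree, Polynomial.leadingCoeff_eq_zero] at hfm
        simpa [hfm] using h.symm
      -- For `n = 0` the resultant is `g.coeff 0 ^ m`, which vanishes only because `m ≠ 0`.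
      by_cases hn : n = 0
      · subst hn
        rw [Polynomial.resultant_zero_right_deg, hgn, zero_pow hm]
      · refine Polynomial.resultant_eq_zero_of_lt_lt _ _ _ _ hf' (lt_of_le_of_ne hg fun h => hn ?_)
        rw [← h, Polynomial.coeff_natDegree, Polynomial.leadingCoeff_eq_zero] at hgn
        simpa [hgn] using h.symm
    · have hg' : g.natDegree = n := le_antisymm hg (Polynomial.le_natDegree_of_ne_zero hgn)
      -- Lowering the formal degree of `f` to the true one only removes, up to sign, a power of the
      -- nonzero leading coefficient of `g`.
      obtain ⟨l, rfl⟩ := Nat.exists_eq_add_of_le hf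
      subst hg'
      rw [Polynomial.resultant_add_left_deg _ _ _ _ _ le_rfl, ← key (.inr (by rintro rfl; simp at hgn))]
      simp_all
  · have hf' : f.natDegree = m := le_antisymm hf (Polynomial.le_natDegree_of_ne_zero hfm)
    obtain ⟨l, rfl⟩ := Nat.exists_eq_add_of_le hg
    subst hf'
    rw [Polynomial.resultant_add_right_deg _ _ _ _ _ le_rfl, ← key (.inl (by rintro rfl; simp at hfm))]
    simp_all

theorem resultant_dehom_eq_zero_iff [IsAlgClosed K] {a b : RingT K} {m n : ℕ} (hm : m ≠ 0)
    (ha : a.IsHomogeneous m) (hb : b.IsHomogeneous n) :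
    Polynomial.resultant (dehom a) (dehom b) m n = 0 ↔
      ∃ t ≠ 0, eval t a = 0 ∧ eval t b = 0 := by
  rw [resultant_eq_zero_iff_exists_root hm (natDegree_dehom_le ha) (natDegree_dehom_le hb),
    coeff_dehom_self ha, coeff_dehom_self hb]
  simp only [eval_dehom]
  constructor
  · rintro (⟨y, h⟩ | h)
    · exact ⟨_, fun h => by simpa using congr_fun h 1, h⟩
    · exact ⟨_, fun h => by simpa using congr_fun h 0, h⟩
  · rintro ⟨t, ht, h1, h2⟩
    by_cases h : t 1 = 0
    · right
      have h0 : t 0 ≠ 0 := fun h0 => ht (by ext i; fin_cases i <;> simp [h0, h])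
      have : t = fun i => t 0 * ![1, 0] i := by ext i; fin_cases i <;> simp [h]
      rw [this, eval_mul_of_isHomogeneous ha] at h1
      rw [this, eval_mul_of_isHomogeneous hb] at h2
      exact ⟨(mul_eq_zero.1 h1).resolve_left (pow_ne_zero _ h0),
        (mul_eq_zero.1 h2).resolve_left (pow_ne_zero _ h0)⟩
    · left
      rw [eval_eq_eval_dehom ha h] at h1
      rw [eval_eq_eval_dehom hb h] at h2
      refine ⟨t 0 / t 1, ?_⟩
      simpa [h, eval_dehom] using And.intro h1 h2

/-- Evaluation of an element of `K[T][X]` at a point of `K² × K³`. -/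
def evalTX (t : Fin 2 → K) (x : Fin 3 → K) : RingTX K →+* K := eval₂Hom (eval t) x

@[simp] lemma evalTX_C (t : Fin 2 → K) (x : Fin 3 → K) (a : RingT K) :
    evalTX t x (C a) = eval t a := by simp [evalTX]
@[simp] lemma evalTX_X (t : Fin 2 → K) (x : Fin 3 → K) (i : Fin 3) :
    evalTX t x (X i) = x i := by simp [evalTX]

/-- Specialization `X ↦ x`, from `K[T][X]` to `K[T]`. -/
def specX (x : Fin 3 → K) : RingTX K →+* RingT K := eval fun i => C (x i)

lemma eval_specX (t : Fin 2 → K) (x : Fin 3 → K) (G : RingTX K) :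
    eval t (specX x G) = evalTX t x G := by
  have : (eval t).comp (specX x) = evalTX t x := by
    ext i <;> simp [specX]
  exact congr($this G)

lemma isHomogeneous_specX (x : Fin 3 → K) {G : RingTX K} {i : ℕ}
    (hG : ∀ m, (G.coeff m).IsHomogeneous i) : (specX x G).IsHomogeneous i := by
  rw [specX, eval_eq]
  refine IsHomogeneous.sum _ _ _ fun m _ => ?_
  have h : ∏ i ∈ m.support, (C (x i) : RingT K) ^ m i = C (∏ i ∈ m.support, x i ^ m i) := by
    simp only [map_prod, map_pow]
  rw [h]
  exact (hG m).mul (isHomogeneous_C (Fin 2) _)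

lemma map_eval_dehomT (x : Fin 3 → K) (G : RingTX K) :
    (dehomT G).map (eval x) = dehom (specX x G) := by
  have : (Polynomial.mapRingHom (eval x)).comp dehomT =
      (dehom : RingT K →ₐ[K] Polynomial K).toRingHom.comp (specX x) := by
    ext i
    · simp [dehomT, specX]
    · fin_cases i <;> simp [dehomT, specX]
    · simp [dehomT, specX]
  exact congr($this G)

theorem eval_resT_eq_zero_iff [IsAlgClosed K] {F G : RingTX K} {m n : ℕ} (hm : m ≠ 0)
    (hF : ∀ s, (F.coeff s).IsHomogeneous m) (hG : ∀ s, (G.coeff s).IsHomogeneous n)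
    (x : Fin 3 → K) :
    eval x (resT F G m n) = 0 ↔ ∃ t ≠ 0, evalTX t x F = 0 ∧ evalTX t x G = 0 := by
  rw [resT, ← Polynomial.resultant_map_map, map_eval_dehomT, map_eval_dehomT,
    resultant_dehom_eq_zero_iff hm (isHomogeneous_specX x hF) (isHomogeneous_specX x hG)]
  simp only [eval_specX]

lemma coeff_coeff_dehomT (G : RingTX K) (l : ℕ) (s : Fin 3 →₀ ℕ) :
    ((dehomT G).coeff l).coeff s = (dehom (G.coeff s)).coeff l := by
  induction G using MvPolynomial.induction_on' with
  | add p q hp hq => simp [hp, hq]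
  | monomial m a =>
    have h1 : (aeval ![(Polynomial.X : Polynomial (RingX K)), 1] a) = (dehom a).map C := by
      have : (aeval ![(Polynomial.X : Polynomial (RingX K)), 1] :
          RingT K →ₐ[K] Polynomial (RingX K)).toRingHom =
        (Polynomial.mapRingHom C).comp (dehom : RingT K →ₐ[K] Polynomial K).toRingHom := by
        ext i
        · simp
        · fin_cases i <;> simp
      exact congr($this a)
    have h2 : dehomT (monomial m a) = (dehom a).map C * Polynomial.C (monomial m 1) := by
      rw [dehomT, coe_eval₂Hom, eval₂_monomial, monomial_eq, C_1, one_mul, Finsupp.prod,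
        Finsupp.prod, map_prod]
      simp only [map_pow]
      exact congrArg (· * _) h1
    rw [h2, Polynomial.coeff_mul_C, Polynomial.coeff_map, coeff_C_mul, coeff_monomial,
      coeff_monomial]
    split_ifs <;> simp

theorem det_isHomogeneous {n σ R : Type*} [Fintype n] [DecidableEq n] [CommRing R]
    (A : Matrix n n (MvPolynomial σ R)) (c : n → ℕ) (h : ∀ i j, (A i j).IsHomogeneous (c j)) :
    A.det.IsHomogeneous (∑ j, c j) := by
  rw [Matrix.det_apply]
  refine IsHomogeneous.sum _ _ _ fun τ _ => ?_
  have := IsHomogeneous.prod Finset.univ (fun i => A (τ i) i) c fun i _ => h _ _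
  rcases Int.units_eq_one_or (Equiv.Perm.sign τ) with h | h <;> simp only [h, one_smul, Units.neg_smul]
  · exact this
  · exact this.neg

theorem det_degreeOf_le {n σ R : Type*} [Fintype n] [DecidableEq n] [CommRing R]
    (A : Matrix n n (MvPolynomial σ R)) (c : n → ℕ) (a : σ) (h : ∀ i j, (A i j).degreeOf a ≤ c j) :
    A.det.degreeOf a ≤ ∑ j, c j := by
  rw [Matrix.det_apply]
  refine (degreeOf_sum_le _ _ _).trans (Finset.sup_le fun τ _ => ?_)
  have := (degreeOf_prod_le a Finset.univ (fun i => A (τ i) i)).trans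
    (Finset.sum_le_sum fun i _ => h _ _)
  rcases Int.units_eq_one_or (Equiv.Perm.sign τ) with h | h <;> simp only [h, one_smul, Units.neg_smul]
  · exact this
  · rwa [degreeOf_neg]

lemma isHomogeneous_coeff_dehomT {G : RingTX K} {j : ℕ} (hG : G.IsHomogeneous j) (l : ℕ) :
    ((dehomT G).coeff l).IsHomogeneous j := by
  intro s hs
  rw [coeff_coeff_dehomT] at hs
  exact hG fun h => hs (by simp [h])

lemma degreeOf_coeff_dehomT_le (a : Fin 3) (G : RingTX K) (l : ℕ) :
    ((dehomT G).coeff l).degreeOf a ≤ G.degreeOf a := by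
  rw [degreeOf_le_iff]
  intro s hs
  rw [mem_support_iff, coeff_coeff_dehomT] at hs
  exact monomial_le_degreeOf a (mem_support_iff.2 fun h => hs (by simp [h]))

/-- The Sylvester matrix has `m` columns of coefficients of `G` and `n` columns of coefficients of
`F`. -/
theorem resT_isHomogeneous {F G : RingTX K} {a b : ℕ} (hF : F.IsHomogeneous a)
    (hG : G.IsHomogeneous b) (m n : ℕ) : (resT F G m n).IsHomogeneous (m * b + n * a) := by
  have := det_isHomogeneous (Polynomial.sylvester (dehomT F) (dehomT G) m n)
    (Fin.addCases (fun _ => b) (fun _ => a)) (fun i j => by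
      induction j using Fin.addCases with
      | left j =>
        simp only [Polynomial.sylvester, Matrix.of_apply, Fin.addCases_left]
        split_ifs
        · exact isHomogeneous_coeff_dehomT hG _
        · exact isHomogeneous_zero _ _ _
      | right j =>
        simp only [Polynomial.sylvester, Matrix.of_apply, Fin.addCases_right]
        split_ifs
        · exact isHomogeneous_coeff_dehomT hF _
        · exact isHomogeneous_zero _ _ _)
  simpa [Fin.sum_univ_add, resT, Polynomial.resultant] using this

theorem degreeOf_resT_le (c : Fin 3) (F G : RingTX K) (m n : ℕ) :
    (resT F G m n).degreeOf c ≤ m * G.degreeOf c + n * F.degreeOf c := by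
  have := det_degreeOf_le (Polynomial.sylvester (dehomT F) (dehomT G) m n)
    (Fin.addCases (fun _ => G.degreeOf c) (fun _ => F.degreeOf c)) c (fun i j => by
      induction j using Fin.addCases with
      | left j =>
        simp only [Polynomial.sylvester, Matrix.of_apply, Fin.addCases_left]
        split_ifs
        · exact degreeOf_coeff_dehomT_le _ _ _
        · simp
      | right j =>
        simp only [Polynomial.sylvester, Matrix.of_apply, Fin.addCases_right]
        split_ifs
        · exact degreeOf_coeff_dehomT_le _ _ _
        · simp)
  simpa [Fin.sum_univ_add, resT, Polynomial.resultant] using this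

end

/-! ### Syzygies, the Rees ideal and the implicit equation -/

section

theorem homogeneousComponent_mul_of_isHomogeneous {σ R : Type*} [CommSemiring R]
    {b : MvPolynomial σ R} {n : ℕ} (hb : b.IsHomogeneous n) (i : ℕ) (c : MvPolynomial σ R) :
    homogeneousComponent (i + n) (c * b) = homogeneousComponent i c * b := by
  conv_lhs => rw [← sum_homogeneousComponent c, Finset.sum_mul, map_sum]
  have h (l : ℕ) : homogeneousComponent (i + n) (homogeneousComponent l c * b) =
      if l = i then homogeneousComponent i c * b else 0 := by
    rw [homogeneousComponent_of_mem ((homogeneousComponent_isHomogeneous l c).mul hb)]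
    by_cases h : l = i
    · simp [h]
    · rw [if_neg (by omega), if_neg h]
  simp only [h, Finset.sum_ite_eq', Finset.mem_range]
  split_ifs with h
  · rfl
  · rw [homogeneousComponent_eq_zero _ _ (by omega), zero_mul]

theorem homogeneousComponent_mul_of_lt {σ R : Type*} [CommSemiring R]
    {b : MvPolynomial σ R} {n : ℕ} (hb : b.IsHomogeneous n) {i : ℕ} (hi : i < n)
    (c : MvPolynomial σ R) : homogeneousComponent i (c * b) = 0 := by
  conv_lhs => rw [← sum_homogeneousComponent c, Finset.sum_mul, map_sum]
  refine Finset.sum_eq_zero fun l _ => ?_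
  rw [homogeneousComponent_of_mem ((homogeneousComponent_isHomogeneous l c).mul hb),
    if_neg (by omega)]

theorem aeval_sub_aeval_mem {σ R S : Type*} [CommRing R] [CommRing S] [Algebra R S]
    (I : Ideal S) {x y : σ → S} (h : ∀ i, x i - y i ∈ I) (a : MvPolynomial σ R) :
    aeval x a - aeval y a ∈ I := by
  rw [← Ideal.Quotient.eq]
  have : (Ideal.Quotient.mkₐ R I).comp (aeval x) = (Ideal.Quotient.mkₐ R I).comp (aeval y) := by
    ext i
    simpa using Ideal.Quotient.eq.2 (h i)
  exact congr($this a)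

/-- Modulo the linear form, tᵢ Tₗ ≡ Tᵢ tₗ for all l. By homogeneity tᵢⁿ a(T) ≡ Tᵢⁿ a(t) = 0, and
some tᵢ is a unit. -/
theorem linear_dvd_of_eval_eq_zero {a : RingT K} {n : ℕ} (ha : a.IsHomogeneous n)
    {t : Fin 2 → K} (ht : t ≠ 0) (h : eval t a = 0) :
    (C (t 1) * X 0 - C (t 0) * X 1 : RingT K) ∣ a := by
  have key (i : Fin 2) (hi : t i ≠ 0) : (C (t 1) * X 0 - C (t 0) * X 1 : RingT K) ∣ a := by
    have hmem := aeval_sub_aeval_mem (R := K)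
      (Ideal.span {(C (t 1) * X 0 - C (t 0) * X 1 : RingT K)})
      (x := fun l => C (t i) * X l) (y := fun l => X i * C (t l)) (by
        intro l
        rw [Ideal.mem_span_singleton]
        fin_cases i <;> fin_cases l
        · exact ⟨0, by simp; ring⟩
        · exact ⟨-1, by simp; ring⟩
        · exact ⟨1, by simp; ring⟩
        · exact ⟨0, by simp; ring⟩) a
    rw [aeval_mul_of_isHomogeneous ha, aeval_mul_of_isHomogeneous ha] at hmem
    have h2 : aeval (fun l => (C (t l) : RingT K)) a = 0 := by
      have := aeval_algebraMap_apply (RingT K) t a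
      rwa [show aeval t a = 0 from h, map_zero] at this
    rw [h2, mul_zero, sub_zero, Ideal.mem_span_singleton, aeval_X_left_apply, ← C_pow] at hmem
    exact ((isUnit_iff_ne_zero.2 (pow_ne_zero n hi)).map C).dvd_mul_left.1 hmem
  by_cases h0 : t 0 = 0
  · exact key 1 fun h1 => ht (by ext i; fin_cases i <;> simp [h0, h1])
  · exact key 0 h0

theorem exists_eval_ne_zero_of_gcd {ι : Type*} {u : ι → RingT K} {d : ℕ}
    (hu : ∀ i, (u i).IsHomogeneous d) (hgcd : ∀ f : RingT K, (∀ i, f ∣ u i) → IsUnit f)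
    {t : Fin 2 → K} (ht : t ≠ 0) : ∃ i, eval t (u i) ≠ 0 := by
  by_contra! h
  have := (hgcd _ fun i => linear_dvd_of_eval_eq_zero (hu i) ht (h i)).map (eval t)
  simp [mul_comm] at this

theorem dvd_of_forall_dvd_mul {R : Type*} [CommRing R] [IsDomain R] [UniqueFactorizationMonoid R]
    {u : Fin 3 → R} (hgcd : ∀ f : R, (∀ i, f ∣ u i) → IsUnit f) {a b : R}
    (h : ∀ j, a ∣ u j * b) : a ∣ b := by
  let := UniqueFactorizationMonoid.toGCDMonoid R
  have h1 : a ∣ gcd (gcd (u 0) (u 1)) (u 2) * b := by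
    refine (dvd_gcd ?_ (h 2)).trans (gcd_mul_right' b _ _).dvd
    exact (dvd_gcd (h 0) (h 1)).trans (gcd_mul_right' b _ _).dvd
  refine (IsUnit.dvd_mul_left (hgcd _ fun i => ?_)).1 h1
  fin_cases i
  · exact (gcd_dvd_left _ _).trans (gcd_dvd_left _ _)
  · exact (gcd_dvd_left _ _).trans (gcd_dvd_right _ _)
  · exact gcd_dvd_right _ _

/-- uᵢ divides uⱼwᵢ for every j, hence divides wᵢ since the uⱼ have no common factor. The common
quotient has degree 0. -/
theorem exists_eq_C_mul_of_proportional {u w : Fin 3 → RingT K} {d : ℕ}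
    (hu : ∀ i, (u i).IsHomogeneous d) (hw : ∀ i, (w i).IsHomogeneous d)
    (hgcd : ∀ f : RingT K, (∀ i, f ∣ u i) → IsUnit f)
    (h : ∀ i j, u i * w j = u j * w i) (hw0 : w ≠ 0) :
    ∃ c : K, c ≠ 0 ∧ ∀ i, w i = C c * u i := by
  obtain ⟨i, hi⟩ : ∃ i, u i ≠ 0 := by
    by_contra! h0
    have := hgcd 0 fun i => by simp [h0]
    simp at this
  obtain ⟨g, hg⟩ : u i ∣ w i := dvd_of_forall_dvd_mul hgcd fun j => ⟨w j, (h i j).symm⟩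
  have hall (j) : w j = g * u j :=
    mul_left_cancel₀ hi (by rw [h, hg]; ring)
  have hg0 : g ≠ 0 := by
    rintro rfl
    exact hw0 (by ext j; simp [hall])
  have hdeg : g.totalDegree = 0 := by
    have h1 := totalDegree_mul_of_isDomain hg0 hi
    have h2 : g * u i ≠ 0 := mul_ne_zero hg0 hi
    rw [← hall, (hw i).totalDegree (hall i ▸ h2), (hu i).totalDegree hi] at h1
    omega
  rw [totalDegree_eq_zero_iff_eq_C] at hdeg
  refine ⟨coeff 0 g, fun h0 => hg0 (by rw [hdeg, h0, C_0]), fun j => ?_⟩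
  rw [← hdeg, hall]

lemma mem_syz {u a : Fin 3 → RingT K} :
    a ∈ syz u ↔ a 0 * u 0 + a 1 * u 1 + a 2 * u 2 = 0 := by
  simp [syz, Fintype.linearCombination_apply, Fin.sum_univ_three]

variable {u p q : Fin 3 → RingT K} {d μ : ℕ}

lemma IsMuBasis.left_mem (h : IsMuBasis u d μ p q) : p ∈ syz u :=
  h.span_eq ▸ Submodule.subset_span (by simp)

lemma IsMuBasis.right_mem (h : IsMuBasis u d μ p q) : q ∈ syz u :=
  h.span_eq ▸ Submodule.subset_span (by simp)

lemma IsMuBasis.left_ne_zero (h : IsMuBasis u d μ p q) : p ≠ 0 :=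
  h.linearIndependent.ne_zero 0

/-- The Hilbert–Burch theorem: the maximal minors of a `μ`-basis are proportional to `u`. -/
theorem IsMuBasis.hilbertBurch (h : IsMuBasis u d μ p q) (hu : ∀ i, (u i).IsHomogeneous d)
    (hgcd : ∀ f : RingT K, (∀ i, f ∣ u i) → IsUnit f) :
    ∃ c : K, c ≠ 0 ∧ p 1 * q 2 - p 2 * q 1 = C c * u 0 ∧ p 2 * q 0 - p 0 * q 2 = C c * u 1 ∧
      p 0 * q 1 - p 1 * q 0 = C c * u 2 := by
  have hp := mem_syz.1 h.left_mem
  have hq := mem_syz.1 h.right_mem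
  have hdeg : μ + (d - μ) = d := by have := h.le; omega
  have hw (i j k l : Fin 3) : (p i * q j - p k * q l).IsHomogeneous d := by
    conv => arg 2; rw [← hdeg]
    exact ((h.homogeneous_left i).mul (h.homogeneous_right j)).sub
      ((h.homogeneous_left k).mul (h.homogeneous_right l))
  obtain ⟨c, hc, hcw⟩ := exists_eq_C_mul_of_proportional
    (w := ![p 1 * q 2 - p 2 * q 1, p 2 * q 0 - p 0 * q 2, p 0 * q 1 - p 1 * q 0]) hu
    (fun i => by fin_cases i <;> exact hw _ _ _ _) hgcd (by
      have h01 : u 0 * (p 2 * q 0 - p 0 * q 2) = u 1 * (p 1 * q 2 - p 2 * q 1) := by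
        linear_combination p 2 * hq - q 2 * hp
      have h02 : u 0 * (p 0 * q 1 - p 1 * q 0) = u 2 * (p 1 * q 2 - p 2 * q 1) := by
        linear_combination q 1 * hp - p 1 * hq
      have h12 : u 1 * (p 0 * q 1 - p 1 * q 0) = u 2 * (p 2 * q 0 - p 0 * q 2) := by
        linear_combination p 0 * hq - q 0 * hp
      intro i j
      fin_cases i <;> fin_cases j <;> simp [h01, h02, h12]) (by
      intro h0
      have h0' := congr_fun h0 0
      have h1' := congr_fun h0 1
      have h2' := congr_fun h0 2
      simp only [Matrix.cons_val, Pi.zero_apply] at h0' h1' h2'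
      have hli := LinearIndependent.pair_iff.1 h.linearIndependent
      apply h.left_ne_zero
      ext1 i
      -- If all minors vanish, then qᵢ p - pᵢ q = 0 for each i, and linear independence gives pᵢ =
      -- 0.
      have := hli (q i) (-p i) (by
        ext1 j
        simp only [Pi.add_apply, Pi.smul_apply, smul_eq_mul, Pi.zero_apply]
        fin_cases i <;> fin_cases j <;> simp only [Fin.zero_eta, Fin.mk_one, Fin.reduceFinMk] <;> first
          | ring1
          | linear_combination h0'
          | linear_combination h1'
          | linear_combination h2'
          | linear_combination -h0'
          | linear_combination -h1'
          | linear_combination -h2')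
      simpa using this.2)
  exact ⟨c, hc, hcw 0, hcw 1, hcw 2⟩

lemma coeff_reesMap (u : Fin 3 → RingT K) (G : RingTX K) (j : ℕ) :
    (reesMap u G : Polynomial (RingT K)).coeff j = aeval u (homogeneousComponent j G) := by
  have h1 : (reesMap u G : Polynomial (RingT K)) =
      aeval (fun i => Polynomial.monomial 1 (u i)) G := by
    have : (Subalgebra.val _).comp (reesMap u) =
        aeval (fun i => Polynomial.monomial 1 (u i)) := by
      ext i; simp [reesMap]
    exact congr($this G)
  rw [h1]
  have h2 (l : ℕ) : aeval (fun i => Polynomial.monomial 1 (u i)) (homogeneousComponent l G) =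
      Polynomial.X ^ l * Polynomial.C (aeval u (homogeneousComponent l G)) := by
    have h3 : (fun i => Polynomial.monomial 1 (u i)) = fun i => Polynomial.X * Polynomial.C (u i) := by
      ext1 i
      rw [Polynomial.X_mul_C, ← Polynomial.monomial_one_one_eq_X, Polynomial.C_mul_monomial, mul_one]
    rw [h3, aeval_mul_of_isHomogeneous (homogeneousComponent_isHomogeneous l G)]
    congr 1
    exact aeval_algebraMap_apply (Polynomial (RingT K)) u _
  conv_lhs => rw [← sum_homogeneousComponent G, map_sum, Polynomial.finsetSum_coeff]
  simp only [h2, Polynomial.coeff_X_pow_mul', Polynomial.coeff_C]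
  rw [Finset.sum_eq_single j]
  · simp
  · intro b _ hb
    split_ifs <;> first | rfl | omega
  · intro hj
    rw [homogeneousComponent_eq_zero _ _ (by simpa using hj)]
    simp

theorem mem_reesIdeal_iff {G : RingTX K} :
    G ∈ reesIdeal u ↔ ∀ j, aeval u (homogeneousComponent j G) = 0 := by
  rw [reesIdeal, RingHom.mem_ker, ← Subtype.coe_inj]
  simp only [← coeff_reesMap, Polynomial.ext_iff]
  rfl

theorem mem_reesIdeal_iff_of_isHomogeneous {G : RingTX K} {j : ℕ} (hG : G.IsHomogeneous j) :
    G ∈ reesIdeal u ↔ aeval u G = 0 := by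
  rw [mem_reesIdeal_iff]
  constructor
  · intro h
    have := h j
    rwa [homogeneousComponent_of_mem hG, if_pos rfl] at this
  · intro h l
    rw [homogeneousComponent_of_mem hG]
    split_ifs
    · exact h
    · exact map_zero _

lemma toForm_isHomogeneous (a : Fin 3 → RingT K) : (toForm a).IsHomogeneous 1 :=
  IsHomogeneous.sum _ _ _ fun _ _ => isHomogeneous_C_mul_X _ _

lemma coeff_toForm (a : Fin 3 → RingT K) (m : Fin 3 →₀ ℕ) :
    (toForm a).coeff m = ∑ i, if Finsupp.single i 1 = m then a i else 0 := by
  simp [toForm, coeff_sum, coeff_C_mul, coeff_X]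

lemma toForm_isBihomogeneous {a : Fin 3 → RingT K} {n : ℕ} (ha : ∀ i, (a i).IsHomogeneous n) :
    IsBihomogeneous (toForm a) n 1 := by
  refine ⟨toForm_isHomogeneous a, fun m => ?_⟩
  rw [coeff_toForm]
  refine IsHomogeneous.sum _ _ _ fun i _ => ?_
  split_ifs
  · exact ha i
  · exact isHomogeneous_zero _ _ _

lemma aeval_toForm (a : Fin 3 → RingT K) :
    aeval u (toForm a) = a 0 * u 0 + a 1 * u 1 + a 2 * u 2 := by
  simp [toForm, Fin.sum_univ_three]

lemma toForm_mem_reesIdeal {a : Fin 3 → RingT K} (ha : a ∈ syz u) : toForm a ∈ reesIdeal u := by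
  rw [mem_reesIdeal_iff_of_isHomogeneous (toForm_isHomogeneous a), aeval_toForm]
  exact mem_syz.1 ha

lemma evalTX_eval (t : Fin 2 → K) (G : RingTX K) :
    evalTX t (fun i => eval t (u i)) G = eval t (aeval u G) := by
  have : (eval t).comp (aeval u : RingTX K →ₐ[RingT K] RingT K).toRingHom =
      evalTX t fun i => eval t (u i) := by
    ext i <;> simp
  exact congr($this G).symm

lemma evalTX_mul_of_isHomogeneous (t : Fin 2 → K) {G : RingTX K} {j : ℕ} (hG : G.IsHomogeneous j)
    (c : K) (x : Fin 3 → K) : evalTX t (fun i => c * x i) G = c ^ j * evalTX t x G :=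
  eval₂_mul_of_isHomogeneous _ hG c x

variable {E : RingX K}

lemma IsImplicitEquation.pos_of_isHomogeneous (hE : IsImplicitEquation u E) {n : ℕ}
    (hn : E.IsHomogeneous n) : n ≠ 0 := by
  rintro rfl
  rw [← totalDegree_zero_iff_isHomogeneous, totalDegree_eq_zero_iff_eq_C] at hn
  refine hE.irreducible.not_isUnit ?_
  rw [hn]
  refine (isUnit_iff_ne_zero.2 fun h => hE.irreducible.ne_zero ?_).map C
  rw [hn, h, C_0]

lemma IsImplicitEquation.eval_eq_zero (hE : IsImplicitEquation u E)
    (hu : ∀ i, (u i).IsHomogeneous d) (hd : d ≠ 0) (t : Fin 2 → K) :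
    eval (fun i => eval t (u i)) E = 0 := by
  obtain ⟨n, hn⟩ := hE.homogeneous
  by_cases h : (fun i => eval t (u i)) = 0
  · rw [h, eval_zero_of_isHomogeneous hn (hE.pos_of_isHomogeneous hn)]
  · refine (hE.zeros _ h).1 ⟨t, ?_, h, rfl⟩
    rintro rfl
    refine h (funext fun i => ?_)
    rw [eval_zero_of_isHomogeneous (hu i) hd, Pi.zero_apply]

theorem IsImplicitEquation.aeval_eq_zero [Infinite K] (hE : IsImplicitEquation u E)
    (hu : ∀ i, (u i).IsHomogeneous d) (hd : d ≠ 0) : aeval u E = 0 := by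
  apply MvPolynomial.funext
  intro t
  rw [map_zero, ← hE.eval_eq_zero hu hd t]
  have : ((eval t).comp (aeval u : RingX K →ₐ[K] RingT K).toRingHom) =
      eval fun i => eval t (u i) := by
    ext i <;> simp
  exact congr($this E)

theorem IsImplicitEquation.exists_smul_eq (hE : IsImplicitEquation u E) {x : Fin 3 → K}
    (hx : eval x E = 0) : ∃ t ≠ 0, ∃ c : K, x = fun i => c * eval t (u i) := by
  by_cases h : x = 0
  · exact ⟨1, one_ne_zero, 0, by ext i; simp [h]⟩
  · obtain ⟨t, ht, h1, h2⟩ := (hE.zeros x h).2 hx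
    rw [Projectivization.mk_eq_mk_iff'] at h2
    obtain ⟨c, hc⟩ := h2
    exact ⟨t, ht, c, hc.symm⟩

variable [IsAlgClosed K]

theorem dvd_of_forall_eval_eq_zero {σ : Type*} [Finite σ] {E G : MvPolynomial σ K}
    (hE : Irreducible E) (h : ∀ x, eval x E = 0 → eval x G = 0) : E ∣ G := by
  have : (Ideal.span {E}).IsPrime := (Ideal.span_singleton_prime hE.ne_zero).2 hE.prime
  rw [← Ideal.mem_span_singleton, ← IsPrime.vanishingIdeal_zeroLocus (K := K) (Ideal.span {E})]
  intro x hx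
  exact h x (hx E (Ideal.mem_span_singleton_self E))

theorem dvd_pow_of_forall_eval_eq_zero {σ : Type*} [Finite σ] {E G : MvPolynomial σ K}
    (h : ∀ x, eval x G = 0 → eval x E = 0) : ∃ N, G ∣ E ^ N := by
  have : E ∈ vanishingIdeal K (zeroLocus K (Ideal.span {G})) := fun x hx =>
    h x (hx G (Ideal.mem_span_singleton_self G))
  rw [vanishingIdeal_zeroLocus_eq_radical] at this
  simpa only [Ideal.mem_radical_iff, Ideal.mem_span_singleton] using this

theorem IsImplicitEquation.dvd_resT (hE : IsImplicitEquation u E) {F G : RingTX K}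
    {m n a b : ℕ} (hm : m ≠ 0)
    (hF : MemReesPiece u m a F) (hG : MemReesPiece u n b G) : E ∣ resT F G m n := by
  refine dvd_of_forall_eval_eq_zero hE.irreducible fun x hx => ?_
  rw [eval_resT_eq_zero_iff hm hF.2.2 hG.2.2]
  obtain ⟨t, ht, c, rfl⟩ := hE.exists_smul_eq hx
  refine ⟨t, ht, ?_, ?_⟩
  · rw [evalTX_mul_of_isHomogeneous t hF.2.1, evalTX_eval,
      (mem_reesIdeal_iff_of_isHomogeneous hF.2.1).1 hF.1, map_zero, mul_zero]
  · rw [evalTX_mul_of_isHomogeneous t hG.2.1, evalTX_eval,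
      (mem_reesIdeal_iff_of_isHomogeneous hG.2.1).1 hG.1, map_zero, mul_zero]

/-- An element of `K[X]` vanishing on the curve is a multiple of its implicit equation. -/
theorem IsImplicitEquation.dvd_of_aeval_eq_zero (hE : IsImplicitEquation u E) {G : RingX K} {j : ℕ}
    (hG : G.IsHomogeneous j) (h : aeval u G = 0) : E ∣ G := by
  refine dvd_of_forall_eval_eq_zero hE.irreducible fun x hx => ?_
  obtain ⟨t, ht, c, rfl⟩ := hE.exists_smul_eq hx
  rw [eval_mul_of_isHomogeneous hG]
  have : ((eval t).comp (aeval u : RingX K →ₐ[K] RingT K).toRingHom) =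
      eval fun i => eval t (u i) := by
    ext i <;> simp
  have h2 := congr($this G)
  rw [← h2]
  exact mul_eq_zero_of_right _ ((congrArg (eval t) h).trans (map_zero _))

/-- The resultant of a `μ`-basis vanishes only on the curve. -/
theorem IsMuBasis.eval_resT_eq_zero (h : IsMuBasis u d μ p q) (hμ : μ ≠ 0) (hd : d ≠ 0)
    (hu : ∀ i, (u i).IsHomogeneous d) (hgcd : ∀ f : RingT K, (∀ i, f ∣ u i) → IsUnit f)
    (hE : IsImplicitEquation u E) {x : Fin 3 → K}
    (hx : eval x (resT (toForm p) (toForm q) μ (d - μ)) = 0) : eval x E = 0 := by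
  rw [eval_resT_eq_zero_iff hμ (toForm_isBihomogeneous h.homogeneous_left).2
    (toForm_isBihomogeneous h.homogeneous_right).2] at hx
  obtain ⟨t, ht, hp, hq⟩ := hx
  simp only [toForm, Fin.sum_univ_three, map_add, map_mul, evalTX_C, evalTX_X] at hp hq
  obtain ⟨c, hc, h0, h1, h2⟩ := h.hilbertBurch hu hgcd
  apply_fun eval t at h0 h1 h2
  simp only [map_sub, map_mul, eval_C] at h0 h1 h2
  obtain ⟨n, hn⟩ := hE.homogeneous
  obtain ⟨i, hi⟩ := exists_eval_ne_zero_of_gcd hu hgcd ht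
  -- The point `x` is orthogonal to p(t) and q(t), whose cross product is a nonzero multiple of
  -- u(t); so `x` is proportional to u(t).
  have key : x = fun j => (x i / eval t (u i)) * eval t (u j) := by
    have h01 : c * (x 0 * eval t (u 1) - x 1 * eval t (u 0)) = 0 := by
      linear_combination -x 0 * h1 + x 1 * h0 + eval t (p 2) * hq - eval t (q 2) * hp
    have h02 : c * (x 0 * eval t (u 2) - x 2 * eval t (u 0)) = 0 := by
      linear_combination -x 0 * h2 + x 2 * h0 - eval t (p 1) * hq + eval t (q 1) * hp
    have h12 : c * (x 1 * eval t (u 2) - x 2 * eval t (u 1)) = 0 := by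
      linear_combination -x 1 * h2 + x 2 * h1 + eval t (p 0) * hq - eval t (q 0) * hp
    replace h01 := sub_eq_zero.1 ((mul_eq_zero.1 h01).resolve_left hc)
    replace h02 := sub_eq_zero.1 ((mul_eq_zero.1 h02).resolve_left hc)
    replace h12 := sub_eq_zero.1 ((mul_eq_zero.1 h12).resolve_left hc)
    ext j
    rw [div_mul_eq_mul_div, eq_div_iff hi]
    fin_cases i <;> fin_cases j <;> simp only [Fin.zero_eta, Fin.mk_one, Fin.reduceFinMk] <;>
      first | rfl | exact h01 | exact h02 | exact h12 | exact h01.symm | exact h02.symm | exact h12.symm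
  rw [key, eval_mul_of_isHomogeneous hn, hE.eval_eq_zero hu hd, mul_zero]

/-- The resultant of a `μ`-basis is a power of the implicit equation. -/
theorem IsMuBasis.exists_associated_pow (h : IsMuBasis u d μ p q) (hμ : μ ≠ 0) (hd : d ≠ 0)
    (hu : ∀ i, (u i).IsHomogeneous d) (hgcd : ∀ f : RingT K, (∀ i, f ∣ u i) → IsUnit f)
    (hE : IsImplicitEquation u E) {n : ℕ} (hn : E.IsHomogeneous n) :
    ∃ s, Associated (resT (toForm p) (toForm q) μ (d - μ)) (E ^ s) ∧ s * n = d := by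
  obtain ⟨N, hN⟩ := dvd_pow_of_forall_eval_eq_zero fun x =>
    h.eval_resT_eq_zero hμ hd hu hgcd hE (x := x)
  obtain ⟨s, -, hs⟩ := (dvd_prime_pow hE.irreducible.prime _).1 hN
  refine ⟨s, hs, ?_⟩
  obtain ⟨c, hc⟩ := hs
  -- The resultant has degree μ·1 + (d - μ)·1 = d, which must equal `s * n`.
  have h1 := resT_isHomogeneous (toForm_isHomogeneous p) (toForm_isHomogeneous q) μ (d - μ)
  have h2 : (resT (toForm p) (toForm q) μ (d - μ)) ≠ 0 := by
    intro h0
    rw [h0, zero_mul] at hc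
    exact pow_ne_zero s hE.irreducible.ne_zero hc.symm
  have h3 := totalDegree_mul_of_isDomain h2 c.ne_zero
  rw [hc, (hn.pow s).totalDegree (pow_ne_zero s hE.irreducible.ne_zero), h1.totalDegree h2,
    (isUnit_iff_totalDegree_of_isReduced.1 c.isUnit).2] at h3
  have := h.le
  rw [mul_comm]
  omega

end

/-! ### Consequences of the very singular point -/

section
variable {u p q : Fin 3 → RingT K} {d μ : ℕ}

/-- Write s = a p + b q and take components of degree δ. Since δ < d - μ, the term b q contributes
nothing, and s is a homogeneous component of a times p. -/
theorem IsMuBasis.exists_eq_mul_left (h : IsMuBasis u d μ p q) {s : Fin 3 → RingT K} {δ : ℕ}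
    (hs : s ∈ syz u) (hs0 : s ≠ 0) (hδ : ∀ i, (s i).IsHomogeneous δ) (hlt : δ < d - μ) :
    μ ≤ δ ∧ ∃ g : RingT K, g ≠ 0 ∧ ∀ i, s i = g * p i := by
  rw [← h.span_eq, Submodule.mem_span_pair] at hs
  obtain ⟨a, b, rfl⟩ := hs
  have key (i : Fin 3) : (a • p + b • q) i = homogeneousComponent δ (a * p i) := by
    rw [← homogeneousComponent_eq_self (hδ i)]
    simp only [Pi.add_apply, Pi.smul_apply, smul_eq_mul, map_add]
    rw [homogeneousComponent_mul_of_lt (h.homogeneous_right i) hlt, add_zero]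
  have hμ : μ ≤ δ := by
    by_contra! hlt
    refine hs0 (funext fun i => ?_)
    rw [key, homogeneousComponent_mul_of_lt (h.homogeneous_left i) hlt, Pi.zero_apply]
  obtain ⟨l, rfl⟩ := Nat.exists_eq_add_of_le' hμ
  simp only [homogeneousComponent_mul_of_isHomogeneous (h.homogeneous_left _)] at key
  refine ⟨hμ, _, ?_, key⟩
  intro h0
  exact hs0 (funext fun i => by rw [key, h0, zero_mul, Pi.zero_apply])

/-- Restriction of a ternary form to `X₁ = 1`, as a polynomial in `X₂` over `K[X₀]`. -/
def affine : RingX K →ₐ[K] Polynomial (Polynomial K) :=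
  aeval ![Polynomial.C Polynomial.X, 1, Polynomial.X]

lemma affine_eq_sum (E : RingX K) : affine E = ∑ m ∈ E.support,
    Polynomial.C (Polynomial.C (coeff m E) * Polynomial.X ^ m 0) * Polynomial.X ^ m 2 := by
  rw [affine, aeval_def, eval₂_eq']
  refine Finset.sum_congr rfl fun m _ => ?_
  simp [Fin.prod_univ_three, mul_assoc, Polynomial.algebraMap_apply]

lemma natDegree_affine_le (E : RingX K) : (affine E).natDegree ≤ E.degreeOf 2 := by
  rw [affine_eq_sum]
  exact Polynomial.natDegree_sum_le_of_forall_le _ _ fun m hm =>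
    (Polynomial.natDegree_C_mul_X_pow_le _ _).trans (monomial_le_degreeOf 2 hm)

lemma degree_fin_three (m : Fin 3 →₀ ℕ) : m.degree = m 0 + m 1 + m 2 := by
  rw [Finsupp.degree_eq_sum, Fin.sum_univ_three]

lemma coeff_coeff_affine {E : RingX K} {n : ℕ} (hE : E.IsHomogeneous n) {m : Fin 3 →₀ ℕ}
    (hm : m.degree = n) : ((affine E).coeff (m 2)).coeff (m 0) = coeff m E := by
  rw [affine_eq_sum, Polynomial.finsetSum_coeff, Polynomial.finsetSum_coeff,
    Finset.sum_eq_single m]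
  · rw [Polynomial.coeff_C_mul, Polynomial.coeff_X_pow_self, mul_one, Polynomial.coeff_C_mul,
      Polynomial.coeff_X_pow_self, mul_one]
  · intro b hb hne
    have hb' : b.degree = n := by
      by_contra h
      exact mem_support_iff.1 hb (hE.coeff_eq_zero h)
    rw [Polynomial.coeff_C_mul, Polynomial.coeff_X_pow, ← hm, degree_fin_three,
      degree_fin_three] at *
    split_ifs with h2
    · rw [mul_one, Polynomial.coeff_C_mul, Polynomial.coeff_X_pow, if_neg, mul_zero]
      intro h0
      exact hne (by ext i; fin_cases i <;> simp <;> omega)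
    · simp
  · intro h
    simp [notMem_support_iff.1 h]

theorem affine_ne_zero {E : RingX K} {n : ℕ} (hE : E.IsHomogeneous n) (h0 : E ≠ 0) :
    affine E ≠ 0 := by
  obtain ⟨m, hm⟩ := ne_zero_iff.1 h0
  intro h
  rw [← coeff_coeff_affine hE (m := m) (by by_contra h; exact hm (hE.coeff_eq_zero h)), h] at hm
  simp at hm

open IntermediateField in
/-- The projection of the curve from `(0 : 0 : 1)` has degree at most the degree in `X₂` of the
implicit equation. -/
theorem finrank_adjoin_le {u : Fin 3 → RingT K} {d : ℕ} (hu : ∀ i, (u i).IsHomogeneous d)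
    (hproper : IsProper u) {E : RingX K} {n : ℕ} (hE : E.IsHomogeneous n) (hE0 : E ≠ 0)
    (hEu : aeval u E = 0) (h1 : dehom (u 1) ≠ 0) (f : RatFunc K)
    (hf : f = algebraMap _ (RatFunc K) (dehom (u 0)) / algebraMap _ (RatFunc K) (dehom (u 1)))
    (hfC : ¬ ∃ c, f = RatFunc.C c) :
    Module.finrank K⟮f⟯ (RatFunc K) ≤ E.degreeOf 2 := by
  set v : Fin 3 → RatFunc K := fun i => algebraMap _ (RatFunc K) (dehom (u i)) with hv
  have hv1 : v 1 ≠ 0 := by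
    simpa [hv] using h1
  set y : RatFunc K := v 2 / v 1 with hy
  have hvf : v = fun i => v 1 * ![f, 1, y] i := by
    ext i
    fin_cases i
    · change v 0 = v 1 * f
      rw [hf, mul_comm, div_mul_cancel₀ _ hv1]
    · change v 1 = v 1 * 1
      rw [mul_one]
    · change v 2 = v 1 * y
      rw [hy, mul_comm, div_mul_cancel₀ _ hv1]
  have haeval (G : RingX K) : aeval v G = algebraMap _ (RatFunc K) (dehom (aeval u G)) := by
    have : (aeval v : RingX K →ₐ[K] RatFunc K) =
        ((IsScalarTower.toAlgHom K (Polynomial K) (RatFunc K)).comp dehom).comp (aeval u) := by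
      ext i; simp [hv]
    rw [this]; rfl
  set f' : K⟮f⟯ := ⟨f, mem_adjoin_simple_self K f⟩ with hf'
  -- Transcendence of `f` keeps E(f, 1, Y) from being the zero polynomial, so it bounds the degree
  -- of `y` over K(f).
  have htr : Function.Injective (Polynomial.aeval f' : Polynomial K →ₐ[K] K⟮f⟯) := by
    have := transcendental_iff_injective.1 (f.transcendental_of_ne_C hfC)
    intro a b hab
    apply this
    have h2 (a : Polynomial K) : Polynomial.aeval f a = algebraMap K⟮f⟯ _ (Polynomial.aeval f' a) :=
      (Polynomial.aeval_algebraMap_apply _ f' a)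
    rw [h2, h2, hab]
  set W : Polynomial K⟮f⟯ := (affine E).map (Polynomial.aeval f' : Polynomial K →ₐ[K] K⟮f⟯).toRingHom
  have hW0 : W ≠ 0 := (Polynomial.map_ne_zero_iff htr).2 (affine_ne_zero hE hE0)
  have hWdeg : W.natDegree ≤ E.degreeOf 2 :=
    (Polynomial.natDegree_map_le).trans (natDegree_affine_le E)
  have hWy : Polynomial.aeval y W = 0 := by
    have h2 : Polynomial.aeval y W = aeval ![f, 1, y] E := by
      have : ((Polynomial.aeval y : Polynomial K⟮f⟯ →ₐ[K⟮f⟯] RatFunc K).toRingHom.comp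
          (Polynomial.mapRingHom (Polynomial.aeval f' : Polynomial K →ₐ[K] K⟮f⟯).toRingHom)).comp
          (affine : RingX K →ₐ[K] _).toRingHom =
          (aeval ![f, 1, y] : RingX K →ₐ[K] RatFunc K).toRingHom := by
        ext i
        · simp [affine]
        · fin_cases i <;> simp [affine, hf']
      exact congr($this E)
    have h3 := haeval E
    rw [hEu, map_zero, map_zero, hvf, aeval_mul_of_isHomogeneous hE] at h3
    rw [h2]
    exact (mul_eq_zero.1 h3).resolve_left (pow_ne_zero _ hv1)
  have hint : IsIntegral K⟮f⟯ y := by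
    rw [← isAlgebraic_iff_isIntegral]
    exact ⟨W, hW0, hWy⟩
  -- This is where birationality enters: the inverse map writes the variable as A(f, 1, y) / B(f, 1,
  -- y).
  have htop : K⟮f⟯⟮y⟯ = ⊤ := by
    have hmem (G : RingX K) : aeval ![f, 1, y] G ∈ K⟮f⟯⟮y⟯ := by
      have hvar : ∀ i, ![f, 1, y] i ∈ K⟮f⟯⟮y⟯ := by
        intro i
        fin_cases i
        · exact K⟮f⟯⟮y⟯.algebraMap_mem f'
        · exact one_mem _
        · exact mem_adjoin_simple_self _ y
      rw [aeval_def, eval₂_eq']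
      refine sum_mem fun m _ => mul_mem ?_ (prod_mem fun i _ => pow_mem (hvar i) _)
      rw [IsScalarTower.algebraMap_apply K K⟮f⟯ (RatFunc K)]
      exact K⟮f⟯⟮y⟯.algebraMap_mem _
    obtain ⟨l, A, B, hA, hB, h0, hAB⟩ := hproper
    have hB0 : aeval u B ≠ 0 := by
      intro hB0
      rw [hB0, mul_zero] at hAB
      exact h0 ⟨(mul_eq_zero.1 hAB).resolve_left (X_ne_zero 1), hB0⟩
    have hB0' : dehom (aeval u B) ≠ 0 := fun h =>
      hB0 (dehom_injective_of_isHomogeneous (hB.aeval u hu) (isHomogeneous_zero _ _ _)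
        (by rw [h, map_zero]))
    have hX : (RatFunc.X : RatFunc K) = aeval ![f, 1, y] A / aeval ![f, 1, y] B := by
      have hA' := haeval A
      have hB' := haeval B
      apply_fun dehom at hAB
      rw [map_mul, map_mul, dehom_X_zero, dehom_X_one, one_mul] at hAB
      have hBne : aeval v B ≠ 0 := by
        rw [hB']; simpa using hB0'
      rw [hAB, map_mul, ← hB', RatFunc.algebraMap_X] at hA'
      rw [hvf, aeval_mul_of_isHomogeneous hA, aeval_mul_of_isHomogeneous hB] at hA'
      rw [hvf, aeval_mul_of_isHomogeneous hB] at hBne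
      have hne := right_ne_zero_of_mul hBne
      rw [eq_div_iff hne]
      refine mul_left_cancel₀ (pow_ne_zero l hv1) ?_
      rw [hA']; ring
    rw [← RatFunc.IntermediateField.adjoin_X K⟮f⟯, eq_comm]
    apply le_antisymm
    · rw [adjoin_simple_le_iff, hX]
      exact div_mem (hmem A) (hmem B)
    · rw [RatFunc.IntermediateField.adjoin_X]; exact le_top
  rw [← IntermediateField.finrank_top', ← htop, IntermediateField.adjoin.finrank hint]
  exact (Polynomial.natDegree_le_natDegree (minpoly.degree_le_of_ne_zero _ _ hW0 hWy)).trans hWdeg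

/-- Write u₀/u₁ as a reduced fraction. Its denominator and minus its numerator, homogenized to the
degree of the fraction, are the first two entries; that degree is [K(T) : K(f)] when f is not
constant. If u₁ = 0, the second unit vector serves. -/
theorem exists_syzygy_of_isProper {u : Fin 3 → RingT K} {d : ℕ} (hu : ∀ i, (u i).IsHomogeneous d)
    (hproper : IsProper u) {E : RingX K} {n : ℕ} (hE : E.IsHomogeneous n) (hE0 : E ≠ 0)
    (hEu : aeval u E = 0) : ∃ δ ≤ E.degreeOf 2, ∃ s ∈ syz u, s ≠ 0 ∧ s 2 = 0 ∧
      ∀ i, (s i).IsHomogeneous δ := by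
  by_cases h1 : dehom (u 1) = 0
  · have : u 1 = 0 := dehom_injective_of_isHomogeneous (hu 1) (isHomogeneous_zero _ _ _)
      (by rw [h1, map_zero])
    refine ⟨0, Nat.zero_le _, ![0, 1, 0], ?_, ?_, rfl, ?_⟩
    · simp [mem_syz, this]
    · intro h; simpa using congr_fun h 1
    · intro i
      fin_cases i
      · exact isHomogeneous_zero _ _ _
      · exact isHomogeneous_one _ _
      · exact isHomogeneous_zero _ _ _
  · set f := algebraMap _ (RatFunc K) (dehom (u 0)) / algebraMap _ (RatFunc K) (dehom (u 1)) with hf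
    have hδ : max f.num.natDegree f.denom.natDegree ≤ E.degreeOf 2 := by
      by_cases hfC : ∃ c, f = RatFunc.C c
      · obtain ⟨c, hc⟩ := hfC
        rw [hc]; simp
      · rw [← RatFunc.finrank_eq_max_natDegree]
        exact finrank_adjoin_le hu hproper hE hE0 hEu h1 f hf hfC
    set δ := max f.num.natDegree f.denom.natDegree
    have hrel : f.denom * dehom (u 0) = f.num * dehom (u 1) := by
      have h2 : algebraMap _ (RatFunc K) (dehom (u 1)) ≠ 0 := by simpa using h1
      have h3 : algebraMap _ (RatFunc K) f.denom ≠ 0 := by simpa using f.denom_ne_zero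
      apply RatFunc.algebraMap_injective K
      have := f.num_div_denom
      rw [hf, div_eq_div_iff h3 h2, ← hf] at this
      rw [map_mul, map_mul, this, mul_comm]
    have hn : dehom (f.num.homogenize δ) = f.num := dehom_homogenize (le_max_left _ _)
    have hdn : dehom (f.denom.homogenize δ) = f.denom := dehom_homogenize (le_max_right _ _)
    refine ⟨δ, hδ, ![f.denom.homogenize δ, -f.num.homogenize δ, 0], ?_, ?_, rfl, ?_⟩
    · rw [mem_syz]
      simp only [Matrix.cons_val]
      rw [zero_mul, add_zero, neg_mul, ← sub_eq_add_neg, sub_eq_zero]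
      refine dehom_injective_of_isHomogeneous
        ((Polynomial.isHomogeneous_homogenize _).mul (hu 0))
        ((Polynomial.isHomogeneous_homogenize _).mul (hu 1)) ?_
      rw [map_mul, map_mul, hn, hdn, hrel]
    · intro h
      have := congr_fun h 0
      simp only [Matrix.cons_val, Pi.zero_apply] at this
      rw [this, map_zero] at hdn
      exact f.denom_ne_zero hdn.symm
    · intro i
      fin_cases i
      · exact Polynomial.isHomogeneous_homogenize _
      · exact (Polynomial.isHomogeneous_homogenize _).neg
      · exact isHomogeneous_zero _ _ _

/-- The multiplicity at `(0 : 0 : 1)` is at most `n - deg_{X₂} E`. -/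
theorem multAt_le {E : RingX K} {n : ℕ} (hE : E.IsHomogeneous n) (hE0 : E ≠ 0) :
    multAt E ![0, 0, 1] + E.degreeOf 2 ≤ n := by
  obtain ⟨m, hm, hmD⟩ : ∃ m ∈ E.support, m 2 = E.degreeOf 2 := by
    rw [degreeOf_eq_sup]
    obtain ⟨m, hm, h⟩ := Finset.exists_mem_eq_sup E.support (support_nonempty.2 hE0) fun m => m 2
    exact ⟨m, hm, h.symm⟩
  have hdeg (b) (hb : b ∈ E.support) : b.degree = n := by
    by_contra h
    exact mem_support_iff.1 hb (hE.coeff_eq_zero h)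
  -- Take a monomial of `E` of highest degree in X₂ and drop its X₂-part. After X₂ ↦ X₂ + 1 its
  -- coefficient is unchanged: by homogeneity no other monomial of `E` has the same exponents in X₀
  -- and X₁.
  set m' : Fin 3 →₀ ℕ := Finsupp.single 0 (m 0) + Finsupp.single 1 (m 1) with hm'
  have hterm (b : Fin 3 →₀ ℕ) : algebraMap K (RingX K) (coeff b E) *
      ∏ i, (X i + C (![0, 0, 1] i) : RingX K) ^ b i =
      monomial (Finsupp.single 0 (b 0) + Finsupp.single 1 (b 1)) (coeff b E) *
        (X 2 + C 1) ^ b 2 := by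
    rw [Fin.prod_univ_three, monomial_add_single, monomial_eq, algebraMap_eq]
    simp [mul_assoc]
  have hX2 (e : Fin 3 →₀ ℕ) (l : ℕ) (i : Fin 3) (hi : i ≠ 2) (he : e i ≠ 0) :
      coeff e ((X 2 + C 1 : RingX K) ^ l) = 0 := by
    by_contra h
    have h1 := monomial_le_degreeOf i (mem_support_iff.2 h)
    have h2 : ((X 2 + C 1 : RingX K) ^ l).degreeOf i = 0 := by
      rw [← Nat.le_zero]
      refine (degreeOf_pow_le _ _ _).trans ?_
      refine (Nat.mul_le_mul_left l (degreeOf_add_le i _ _)).trans ?_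
      simp [degreeOf_X, hi]
    omega
  have hcoeff : coeff m' (aeval (fun i => (X i + C (![0, 0, 1] i) : RingX K)) E) = coeff m E := by
    rw [aeval_def, eval₂_eq', coeff_sum, Finset.sum_eq_single m]
    · rw [hterm, coeff_monomial_mul', if_pos le_rfl, tsub_self, ← constantCoeff_eq]
      simp
    · intro b hb hne
      rw [hterm, coeff_monomial_mul']
      split_ifs with hle
      · have hb0 := hle 0
        have hb1 := hle 1
        simp [hm'] at hb0 hb1
        have hdb := (hdeg b hb).trans (hdeg m hm).symm
        rw [degree_fin_three, degree_fin_three] at hdb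
        by_cases h0 : b 0 = m 0
        · have h1 : b 1 ≠ m 1 := fun h1 => hne (by ext i; fin_cases i <;> simp <;> omega)
          rw [hX2 _ _ 1 (by decide) (by simp [hm']; omega), mul_zero]
        · rw [hX2 _ _ 0 (by decide) (by simp [hm']; omega), mul_zero]
      · rfl
    · intro h; exact absurd hm h
  have := MvPowerSeries.order_le (d := m')
    (f := ((aeval (fun i => (X i + C (![0, 0, 1] i) : RingX K)) E : RingX K) :
      MvPowerSeries (Fin 3) K)) (by
      rw [coeff_coe, hcoeff]; exact mem_support_iff.1 hm)
  have h3 := hdeg m hm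
  rw [degree_fin_three] at h3
  have h4 : m'.degree = m 0 + m 1 := by simp [hm']
  rw [h4] at this
  calc multAt E ![0, 0, 1] + E.degreeOf 2 ≤ ((m 0 + m 1 : ℕ) : ℕ∞) + E.degreeOf 2 := by
        gcongr; exact this
    _ = n := by rw [← hmD, ← h3]; push_cast; ring

variable [IsAlgClosed K] {E : RingX K}

/-- The multiplicity bound gives deg_{X₂} E < deg E - μ ≤ d - μ, so the syzygy coming from the
projection is short enough to be a multiple of `p`. -/
theorem IsMuBasis.left_two_eq_zero (h : IsMuBasis u d μ p q) (hμ : μ ≠ 0)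
    (hu : ∀ i, (u i).IsHomogeneous d) (hgcd : ∀ f : RingT K, (∀ i, f ∣ u i) → IsUnit f)
    (hproper : IsProper u) (hE : IsImplicitEquation u E)
    (hvs : (μ : ℕ∞) < multAt E ![0, 0, 1]) :
    p 2 = 0 ∧ E.IsHomogeneous d ∧ Associated (resT (toForm p) (toForm q) μ (d - μ)) E := by
  obtain ⟨n, hn⟩ := hE.homogeneous
  have hd : d ≠ 0 := by have := h.le; omega
  obtain ⟨s, hs, hsn⟩ := h.exists_associated_pow hμ hd hu hgcd hE hn
  have hs0 : s ≠ 0 := by rintro rfl; omega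
  have hle : n ≤ d := by rw [← hsn]; exact Nat.le_mul_of_pos_left _ (by omega)
  have hD : μ + E.degreeOf 2 < n := by
    have h1 := multAt_le hn hE.irreducible.ne_zero
    have h2 : ((μ + 1 : ℕ) : ℕ∞) + E.degreeOf 2 ≤ n :=
      le_trans (by gcongr; exact_mod_cast Order.add_one_le_of_lt hvs) h1
    norm_cast at h2
    omega
  obtain ⟨δ, hδ, a, ha, ha0, ha2, hah⟩ := exists_syzygy_of_isProper hu hproper hn
    hE.irreducible.ne_zero (hE.aeval_eq_zero hu hd)
  obtain ⟨hμδ, g, hg, hga⟩ := h.exists_eq_mul_left ha ha0 hah (by omega)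
  have hp2 : p 2 = 0 := by
    rw [hga] at ha2
    exact (mul_eq_zero.1 ha2).resolve_left hg
  have hdeg := degreeOf_resT_le 2 (toForm p) (toForm q) μ (d - μ)
  have hdp : (toForm p).degreeOf 2 = 0 := by
    rw [← Nat.le_zero, degreeOf_le_iff]
    intro m hm
    rw [mem_support_iff, coeff_toForm, Fin.sum_univ_three, hp2] at hm
    by_contra hm2
    apply hm
    rw [if_neg, if_neg] <;> [simp; skip; skip] <;> rintro rfl <;> simp at hm2
  have hdq : (toForm q).degreeOf 2 ≤ 1 :=
    (degreeOf_le_totalDegree _ _).trans (toForm_isHomogeneous q).totalDegree_le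
  have hsD : (resT (toForm p) (toForm q) μ (d - μ)).degreeOf 2 = s * E.degreeOf 2 := by
    obtain ⟨c, hc⟩ := hs.symm
    have hdc : (c : RingX K).degreeOf 2 = 0 := Nat.le_zero.1
      ((degreeOf_le_totalDegree _ _).trans (isUnit_iff_totalDegree_of_isReduced.1 c.isUnit).2.le)
    rw [← hc, degreeOf_mul_eq (pow_ne_zero _ hE.irreducible.ne_zero) c.ne_zero, hdc,
      degreeOf_pow_eq _ _ _ hE.irreducible.ne_zero, add_zero]
  -- As P is free of X₂, Res(P, Q) has degree at most μ in X₂. Its degree there is s · deg_{X₂} E ≥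
  -- s δ ≥ s μ.
  have hs1 : s = 1 := by
    rw [hsD, hdp, mul_zero, add_zero] at hdeg
    have h1 : s * μ ≤ μ * 1 := (Nat.mul_le_mul_left s (hμδ.trans hδ)).trans
      (hdeg.trans (Nat.mul_le_mul_left μ hdq))
    rw [mul_comm s] at h1
    have := Nat.le_of_mul_le_mul_left h1 (by omega)
    omega
  subst hs1
  rw [one_mul] at hsn
  rw [pow_one] at hs
  exact ⟨hp2, hsn ▸ hn, hs⟩

end

/-! ### The substitution θ and elements of low degree -/

section

/-- A `μ`-basis of a parametrization whose first element is a syzygy of `u₀, u₁`. -/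
structure IsSplitMuBasis (u : Fin 3 → RingT K) (d μ : ℕ) (p q : Fin 3 → RingT K) : Prop
    extends IsMuBasis u d μ p q where
  homogeneous : ∀ i, (u i).IsHomogeneous d
  isUnit_of_dvd : ∀ f : RingT K, (∀ i, f ∣ u i) → IsUnit f
  ne_zero : μ ≠ 0
  two_eq_zero : p 2 = 0

variable {u p q : Fin 3 → RingT K} {d μ : ℕ}

namespace IsSplitMuBasis

theorem exists_const (h : IsSplitMuBasis u d μ p q) : ∃ c : K, c ≠ 0 ∧
    u 0 = C c * (p 1 * q 2) ∧ u 1 = C c * -(p 0 * q 2) ∧ u 2 = C c * (p 0 * q 1 - p 1 * q 0) := by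
  obtain ⟨c, hc, h0, h1, h2⟩ := h.hilbertBurch h.homogeneous h.isUnit_of_dvd
  have hcc (a : RingT K) : C c⁻¹ * (C c * a) = a := by
    rw [← mul_assoc, ← C_mul, inv_mul_cancel₀ hc, C_1, one_mul]
  refine ⟨c⁻¹, inv_ne_zero hc, ?_, ?_, ?_⟩
  · rw [← hcc (u 0), ← h0, h.two_eq_zero]; ring
  · rw [← hcc (u 1), ← h1, h.two_eq_zero]; ring
  · rw [← hcc (u 2), ← h2]

theorem isRelPrime (h : IsSplitMuBasis u d μ p q) : IsRelPrime (p 0) (p 1) := by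
  intro f h0 h1
  obtain ⟨c, -, e0, e1, e2⟩ := h.exists_const
  refine h.isUnit_of_dvd f fun i => ?_
  fin_cases i
  · exact e0 ▸ (h1.mul_right _).mul_left _
  · exact e1 ▸ ((h0.mul_right _).neg_right).mul_left _
  · exact e2 ▸ (dvd_sub (h0.mul_right _) (h1.mul_right _)).mul_left _

theorem _root_.ReesCurve.not_isUnit_of_isHomogeneous {σ : Type*} {a : MvPolynomial σ K} {n : ℕ}
    (ha : a.IsHomogeneous n) (hn : n ≠ 0) : ¬ IsUnit a := fun hu =>
  hn ((ha.totalDegree hu.ne_zero).symm.trans (isUnit_iff_totalDegree_of_isReduced.1 hu).2)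

theorem one_ne_zero (h : IsSplitMuBasis u d μ p q) : p 1 ≠ 0 := fun h1 =>
  not_isUnit_of_isHomogeneous (h.homogeneous_left 0) h.ne_zero
    (h.isRelPrime dvd_rfl (h1 ▸ dvd_zero _))

theorem right_two_ne_zero (h : IsSplitMuBasis u d μ p q) : q 2 ≠ 0 := by
  intro h2
  obtain ⟨c, -, e0, e1, -⟩ := h.exists_const
  rw [h2, mul_zero] at e0 e1
  refine not_isUnit_of_isHomogeneous (h.homogeneous 2) ?_ (h.isUnit_of_dvd (u 2) fun i => ?_)
  · have := h.le; have := h.ne_zero; omega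
  · fin_cases i
    · exact ⟨0, by simp [e0]⟩
    · exact ⟨0, by simp [e1]⟩
    · exact dvd_rfl

theorem isRelPrime_right (h : IsSplitMuBasis u d μ p q) : IsRelPrime (q 2) (u 2) := by
  intro f h0 h1
  obtain ⟨c, -, e0, e1, -⟩ := h.exists_const
  refine h.isUnit_of_dvd f fun i => ?_
  fin_cases i
  · exact e0 ▸ (h0.mul_left _).mul_left _
  · exact e1 ▸ ((h0.mul_left _).neg_right).mul_left _
  · exact h1

end IsSplitMuBasis

/-- The substitution `X₀ ↦ p⁰ = -p₁`, `X₁ ↦ p¹ = p₀`, `X₂ ↦ Y`. -/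
def theta (p : Fin 3 → RingT K) : RingTX K →ₐ[RingT K] Polynomial (RingT K) :=
  aeval ![Polynomial.C (-p 1), Polynomial.C (p 0), Polynomial.X]

lemma theta_eq_sum (p : Fin 3 → RingT K) (G : RingTX K) : theta p G = ∑ m ∈ G.support,
    Polynomial.C (coeff m G * ((-p 1) ^ m 0 * p 0 ^ m 1)) * Polynomial.X ^ m 2 := by
  rw [theta, aeval_def, eval₂_eq']
  refine Finset.sum_congr rfl fun m _ => ?_
  simp [Fin.prod_univ_three, mul_assoc]

lemma theta_coeff_eq_zero (p : Fin 3 → RingT K) {G : RingTX K} {j b : ℕ} (hG : G.IsHomogeneous j)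
    (hb : j < b) : (theta p G).coeff b = 0 := by
  rw [theta_eq_sum, Polynomial.finsetSum_coeff]
  refine Finset.sum_eq_zero fun m hm => ?_
  have hm' : m.degree = j := by
    by_contra h
    exact mem_support_iff.1 hm (hG.coeff_eq_zero h)
  rw [degree_fin_three] at hm'
  rw [Polynomial.coeff_C_mul, Polynomial.coeff_X_pow, if_neg (by omega), mul_zero]

lemma theta_coeff_isHomogeneous (hp : ∀ i, (p i).IsHomogeneous μ) {G : RingTX K} {i j : ℕ}
    (hG : IsBihomogeneous G i j) (b : ℕ) :
    ((theta p G).coeff b).IsHomogeneous (i + μ * (j - b)) := by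
  rw [theta_eq_sum, Polynomial.finsetSum_coeff]
  refine IsHomogeneous.sum _ _ _ fun m hm => ?_
  have hm' : m.degree = j := by
    by_contra h
    exact mem_support_iff.1 hm (hG.1.coeff_eq_zero h)
  rw [degree_fin_three] at hm'
  rw [Polynomial.coeff_C_mul, Polynomial.coeff_X_pow]
  split_ifs with hb
  · rw [mul_one, show j - b = m 0 + m 1 by omega, mul_add]
    exact (hG.2 m).mul ((((hp 1).neg).pow _).mul ((hp 0).pow _))
  · rw [mul_zero]; exact isHomogeneous_zero _ _ _

lemma toForm_eq (a : Fin 3 → RingT K) : toForm a = C (a 0) * X 0 + C (a 1) * X 1 + C (a 2) * X 2 := by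
  simp [toForm, Fin.sum_univ_three]

/-- Specialization of `θ(G)` at an element of a field containing the coefficients. -/
lemma aeval_theta {L : Type*} [Field L] [Algebra (RingT K) L] (y : L) (G : RingTX K) :
    Polynomial.aeval y (theta p G) =
      aeval ![algebraMap (RingT K) L (-p 1), algebraMap (RingT K) L (p 0), y] G := by
  have : (Polynomial.aeval y).comp (theta p) =
      aeval ![algebraMap (RingT K) L (-p 1), algebraMap (RingT K) L (p 0), y] := by
    ext i
    fin_cases i <;> simp [theta]
  exact congr($this G)

namespace IsSplitMuBasis

lemma toForm_left (h : IsSplitMuBasis u d μ p q) : toForm p = C (p 0) * X 0 + C (p 1) * X 1 := by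
  rw [toForm_eq, h.two_eq_zero, C_0, zero_mul, add_zero]

lemma theta_left (h : IsSplitMuBasis u d μ p q) : theta p (toForm p) = 0 := by
  rw [h.toForm_left]
  simp [theta]
  ring

lemma theta_right_ne_zero (h : IsSplitMuBasis u d μ p q) : theta p (toForm q) ≠ 0 := by
  intro h0
  apply h.right_two_ne_zero
  have : (theta p (toForm q)).coeff 1 = q 2 := by
    have h1 : theta p (toForm q) =
        Polynomial.C (q 0 * -p 1 + q 1 * p 0) + Polynomial.C (q 2) * Polynomial.X := by
      rw [toForm_eq]
      simp [theta]
      ring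
    rw [h1, Polynomial.coeff_add, Polynomial.coeff_C_succ, Polynomial.coeff_C_mul,
      Polynomial.coeff_X_one, zero_add, mul_one]
  rw [← this, h0, Polynomial.coeff_zero]

/-- `θ(G)` vanishes at `u₂ / g`, where `u₀ = g p⁰` and `u₁ = g p¹`, for `G` in the Rees ideal. -/
theorem dvd_leadingCoeff_theta (h : IsSplitMuBasis u d μ p q) {G : RingTX K} {j : ℕ}
    (hG : G.IsHomogeneous j) (hGu : aeval u G = 0) :
    q 2 ∣ (theta p G).leadingCoeff ∧ (theta p G ≠ 0 → (theta p G).natDegree ≠ 0) := by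
  obtain ⟨c, hc, e0, e1, -⟩ := h.exists_const
  set L := FractionRing (RingT K)
  let ι := algebraMap (RingT K) L
  have hι : Function.Injective ι := IsFractionRing.injective _ _
  set g : RingT K := C (-c) * q 2 with hg
  have hg0 : g ≠ 0 := mul_ne_zero (by simpa using hc) h.right_two_ne_zero
  have hιg : ι g ≠ 0 := by simpa using (map_ne_zero_iff ι hι).2 hg0
  set y : L := ι (u 2) / ι g with hy
  -- By homogeneity, θ(G)(u₂/g) is G(u) divided by a power of g.
  have hroot : Polynomial.aeval y (theta p G) = 0 := by
    have h1 : aeval (fun i => ι (u i)) G = 0 := by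
      have := aeval_algebraMap_apply L u G
      rw [show (aeval u) G = 0 from hGu, map_zero] at this
      exact this
    have h2 : (fun i => ι (u i)) = fun i => ι g * ![ι (-p 1), ι (p 0), y] i := by
      ext i
      fin_cases i
      · change ι (u 0) = ι g * ι (-p 1)
        rw [← map_mul, e0, hg, C_neg]; congr 1; ring
      · change ι (u 1) = ι g * ι (p 0)
        rw [← map_mul, e1, hg, C_neg]; congr 1; ring
      · change ι (u 2) = ι g * y
        rw [hy, mul_comm, div_mul_cancel₀ _ hιg]
    rw [h2, aeval_mul_of_isHomogeneous hG] at h1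
    rw [aeval_theta]
    exact (mul_eq_zero.1 h1).resolve_left (pow_ne_zero _ hιg)
  constructor
  · have hden : q 2 ∣ (IsFractionRing.den (RingT K) y : RingT K) := by
      have hnd : ι (IsFractionRing.num (RingT K) y) / ι (IsFractionRing.den (RingT K) y) = y :=
        IsFractionRing.mk'_num_den' (RingT K) y
      have hd0 : ι (IsFractionRing.den (RingT K) y) ≠ 0 :=
        (map_ne_zero_iff ι hι).2 (nonZeroDivisors.coe_ne_zero _)
      nth_rw 3 [hy] at hnd
      rw [div_eq_div_iff hd0 hιg, ← map_mul, ← map_mul] at hnd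
      refine h.isRelPrime_right.dvd_of_dvd_mul_left ?_
      rw [← hι hnd]
      exact (dvd_mul_left _ _).mul_left _
    exact hden.trans (den_dvd_of_is_root hroot)
  · intro h0 hdeg
    rw [Polynomial.natDegree_eq_zero] at hdeg
    obtain ⟨a, ha⟩ := hdeg
    rw [← ha, Polynomial.aeval_C] at hroot
    apply h0
    rw [← ha, (map_eq_zero_iff _ (IsFractionRing.injective (RingT K) L)).1 hroot, Polynomial.C_0]

/-- Otherwise the leading coefficient, at some Y^B with B ≥ 1, has degree i + μ(j - B) and is
divisible by `q 2`, of degree d - μ. This gives i + μj ≥ d - μ + μB ≥ d. -/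
theorem theta_eq_zero_of_lt (h : IsSplitMuBasis u d μ p q) {G : RingTX K} {i j : ℕ}
    (hG : MemReesPiece u i j G) (hlt : i + μ * j < d) : theta p G = 0 := by
  by_contra h0
  obtain ⟨⟨e, he⟩, hB⟩ := h.dvd_leadingCoeff_theta hG.2.1
    ((mem_reesIdeal_iff_of_isHomogeneous hG.2.1).1 hG.1)
  set B := (theta p G).natDegree with hBdef
  have hB0 : B ≠ 0 := hB h0
  have hl0 := Polynomial.leadingCoeff_ne_zero.2 h0
  have hBj : B ≤ j := by
    by_contra! hlt
    exact hl0 (theta_coeff_eq_zero p hG.2.1 hlt)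
  have h1 := (theta_coeff_isHomogeneous h.homogeneous_left hG.2 B).totalDegree hl0
  change (theta p G).leadingCoeff.totalDegree = _ at h1
  rw [he] at hl0
  rw [he, totalDegree_mul_of_isDomain (left_ne_zero_of_mul hl0) (right_ne_zero_of_mul hl0),
    (h.homogeneous_right 2).totalDegree (left_ne_zero_of_mul hl0)] at h1
  obtain ⟨l, rfl⟩ := Nat.exists_eq_add_of_le hBj
  rw [Nat.add_sub_cancel_left] at h1
  have h2 : μ * 1 ≤ μ * B := Nat.mul_le_mul_left μ (by omega)
  rw [mul_add] at hlt
  have := h.le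
  omega

/-- Modulo P one has p⁰X₁ ≡ p¹X₀, so (p⁰)ʲ G ≡ G(p⁰X₀, p¹X₀, p⁰X₂). The latter is X₀ʲ times the
value of θ(G) at p⁰X₂/X₀, namely 0. Finally p⁰ is prime to P. -/
theorem dvd_of_theta_eq_zero (h : IsSplitMuBasis u d μ p q) {G : RingTX K} {j : ℕ}
    (hG : G.IsHomogeneous j) (h0 : theta p G = 0) : toForm p ∣ G := by
  set L := FractionRing (RingTX K)
  let ι := algebraMap (RingTX K) L
  have hι : Function.Injective ι := IsFractionRing.injective _ _
  have hιC (a : RingT K) : algebraMap (RingT K) L a = ι (C a) :=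
    IsScalarTower.algebraMap_apply (RingT K) (RingTX K) L a
  have hX0 : ι (X 0) ≠ 0 := (map_ne_zero_iff ι hι).2 (X_ne_zero 0)
  set w : Fin 3 → RingTX K := ![C (-p 1) * X 0, C (p 0) * X 0, C (-p 1) * X 2] with hw
  have hβ : aeval w G = 0 := by
    apply hι
    set y : L := ι (C (-p 1) * X 2) / ι (X 0) with hy
    have h1 := aeval_algebraMap_apply L w G
    have h2 : (fun i => ι (w i)) = fun i =>
        ι (X 0) * ![algebraMap (RingT K) L (-p 1), algebraMap (RingT K) L (p 0), y] i := by
      ext i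
      fin_cases i
      · change ι (C (-p 1) * X 0) = ι (X 0) * algebraMap (RingT K) L (-p 1)
        rw [map_mul, hιC, mul_comm]
      · change ι (C (p 0) * X 0) = ι (X 0) * algebraMap (RingT K) L (p 0)
        rw [map_mul, hιC, mul_comm]
      · change ι (C (-p 1) * X 2) = ι (X 0) * y
        rw [hy, mul_comm (ι (X 0)), div_mul_cancel₀ _ hX0]
    have h3 : aeval (fun i => ι (w i)) G = 0 := by
      rw [h2, aeval_mul_of_isHomogeneous hG, ← aeval_theta, h0, map_zero, mul_zero]
    rw [map_zero, ← h3]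
    exact h1.symm
  have hmem := aeval_sub_aeval_mem (Ideal.span {toForm p})
    (x := fun l => C (-p 1) * X l) (y := w) (by
      intro l
      rw [Ideal.mem_span_singleton, h.toForm_left]
      fin_cases l
      · simp [hw]
      · exact ⟨-1, by simp [hw]; ring⟩
      · simp [hw]) G
  rw [hβ, sub_zero, aeval_mul_of_isHomogeneous hG, aeval_X_left_apply,
    Ideal.mem_span_singleton] at hmem
  -- A divisor of p⁰ is constant in X; if it divides P too, it divides both of its coprime
  -- coefficients.
  have hrel : IsRelPrime (toForm p) (C (-p 1) : RingTX K) := by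
    intro f hf1 ⟨e, he⟩
    have hne : f * e ≠ 0 := by
      rw [← he]; simpa using h.one_ne_zero
    have hdeg := totalDegree_mul_of_isDomain (left_ne_zero_of_mul hne) (right_ne_zero_of_mul hne)
    rw [← he, totalDegree_C] at hdeg
    have hfC := totalDegree_eq_zero_iff_eq_C.1 (show f.totalDegree = 0 by omega)
    rw [hfC, C_dvd_iff_dvd_coeff] at hf1
    have c0 := hf1 (Finsupp.single 0 1)
    have c1 := hf1 (Finsupp.single 1 1)
    rw [coeff_toForm, Fin.sum_univ_three] at c0 c1
    simp [Finsupp.single_left_inj] at c0 c1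
    rw [hfC]
    exact (h.isRelPrime c0 c1).map C
  exact (hrel.pow_right).dvd_of_dvd_mul_left hmem

theorem dvd_of_lt (h : IsSplitMuBasis u d μ p q) {G : RingTX K} {i j : ℕ}
    (hG : MemReesPiece u i j G) (hlt : i + μ * j < d) : toForm p ∣ G :=
  h.dvd_of_theta_eq_zero hG.2.1 (h.theta_eq_zero_of_lt hG hlt)

end IsSplitMuBasis

/-! ### The operator 𝒟_T and the family F_j -/

lemma IsBihomogeneous.add {G H : RingTX K} {i j : ℕ} (hG : IsBihomogeneous G i j)
    (hH : IsBihomogeneous H i j) : IsBihomogeneous (G + H) i j :=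
  ⟨hG.1.add hH.1, fun m => by rw [coeff_add]; exact (hG.2 m).add (hH.2 m)⟩

lemma IsBihomogeneous.X_mul {G : RingTX K} {i j : ℕ} (hG : IsBihomogeneous G i j) (l : Fin 3) :
    IsBihomogeneous (X l * G) i (j + 1) := by
  refine ⟨add_comm 1 j ▸ (isHomogeneous_X _ l).mul hG.1, fun m => ?_⟩
  rw [coeff_X_mul']
  split_ifs
  · exact hG.2 _
  · exact isHomogeneous_zero _ _ _

theorem IsDT.isBihomogeneous {p0 p1 : RingT K} {i j : ℕ} {G H : RingTX K}
    (h : IsDT μ p0 p1 i j G H) : IsBihomogeneous H (i - μ) (j + 1) := by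
  obtain ⟨-, -, G0, G1, h0, h1, -, rfl⟩ := h
  exact (h0.X_mul 0).add (h1.X_mul 1)

theorem IsSplitMuBasis.isDT_spec (h : IsSplitMuBasis u d μ p q) {i j : ℕ} {G H : RingTX K}
    (hD : IsDT μ (-p 1) (p 0) i j G H) : theta p H = theta p G ∧
      ∃ G1, C (-p 1) * H = X 0 * G - G1 * toForm p := by
  obtain ⟨-, -, G0, G1, -, -, rfl, rfl⟩ := hD
  refine ⟨by simp [theta], G1, ?_⟩
  rw [h.toForm_left, C_neg]
  ring

/-- All three properties pass from F_j to F_{j+1} through `isDT_spec`. The last serves to show that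
Res(P, F_j) is nonzero. -/
theorem IsSplitMuBasis.isFamily_spec (h : IsSplitMuBasis u d μ p q) {k : ℕ} {F : ℕ → RingTX K}
    (hF : IsFamily d μ k p q F) {j : ℕ} (hj : 1 ≤ j) (hjk : j ≤ k - 1) :
    MemReesPiece u (d - j * μ) j (F j) ∧ theta p (F j) = theta p (toForm q) ∧
    ∀ t x, x 0 ≠ 0 → evalTX t x (toForm p) = 0 → evalTX t x (F j) = 0 →
      evalTX t x (toForm q) = 0 := by
  induction j, hj using Nat.le_induction with
  | base =>
    rw [hF.1, one_mul]
    exact ⟨⟨toForm_mem_reesIdeal h.right_mem, toForm_isBihomogeneous h.homogeneous_right⟩, rfl,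
      fun _ _ _ _ h => h⟩
  | succ j hj ih =>
    obtain ⟨hmem, hθ, hev⟩ := ih (by omega)
    have hD := hF.2 (j + 1) (by omega) hjk
    rw [Nat.add_sub_cancel] at hD
    have hbi := hD.isBihomogeneous
    rw [Nat.sub_sub, ← Nat.succ_mul] at hbi
    obtain ⟨hθ', G1, hG1⟩ := h.isDT_spec hD
    refine ⟨⟨?_, hbi⟩, hθ'.trans hθ, fun t x hx hP hFj => hev t x hx hP ?_⟩
    · rw [mem_reesIdeal_iff_of_isHomogeneous hbi.1]
      have h1 := congrArg (aeval u) hG1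
      rw [map_sub, map_mul, map_mul, map_mul,
        (mem_reesIdeal_iff_of_isHomogeneous hmem.2.1).1 hmem.1,
        (mem_reesIdeal_iff_of_isHomogeneous (toForm_isHomogeneous p)).1
          (toForm_mem_reesIdeal h.left_mem), mul_zero, mul_zero, sub_zero] at h1
      refine (mul_eq_zero.1 h1).resolve_left ?_
      simpa using h.one_ne_zero
    · have h1 := congrArg (evalTX t x) hG1
      rw [map_mul, map_sub, map_mul, map_mul, hFj, hP, mul_zero, mul_zero, sub_zero,
        evalTX_X] at h1
      exact (mul_eq_zero.1 h1.symm).resolve_left hx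

section Decomposition

theorem eval_ne_zero_of_isRelPrime {a b : RingT K} {m n : ℕ} (ha : a.IsHomogeneous m)
    (hb : b.IsHomogeneous n) (hab : IsRelPrime a b) {t : Fin 2 → K} (ht : t ≠ 0) :
    eval t a ≠ 0 ∨ eval t b ≠ 0 := by
  by_contra! h
  have := (hab (linear_dvd_of_eval_eq_zero ha ht h.1)
    (linear_dvd_of_eval_eq_zero hb ht h.2)).map (eval t)
  simp [mul_comm] at this

/-- Reduce a Bézout coefficient modulo `b` to get deg x < m. Then b y = g - a x has degree at most
max(i, 2m - 1), and the hypothesis `hi` makes this at most i. -/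
theorem exists_bezout_of_natDegree {a b g : Polynomial K} {m i : ℕ} (hm : m ≠ 0)
    (ha : a.natDegree ≤ m) (hb : b.natDegree = m) (hab : IsCoprime a b) (hg : g.natDegree ≤ i)
    (hi : 2 * m ≤ i + 1) : ∃ x y : Polynomial K, x.natDegree ≤ i - m ∧ y.natDegree ≤ i - m ∧
      g = a * x + b * y := by
  obtain ⟨r, s, hrs⟩ := hab
  have hx : ((g * r) % b).natDegree < m := hb ▸ Polynomial.natDegree_mod_lt _ (by omega)
  have hb0 : b ≠ 0 := by rintro rfl; simp at hb; omega
  have heq : g = a * ((g * r) % b) + b * (g * s + a * ((g * r) / b)) := by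
    have h1 := EuclideanDomain.div_add_mod (g * r) b
    linear_combination -g * hrs - a * h1
  refine ⟨(g * r) % b, g * s + a * ((g * r) / b), by omega, ?_, heq⟩
  set y := g * s + a * ((g * r) / b)
  by_cases hy : y = 0
  · simp [hy]
  have h1 : (b * y).natDegree ≤ i := by
    rw [show b * y = g - a * ((g * r) % b) from by linear_combination -heq]
    refine (Polynomial.natDegree_sub_le _ _).trans (max_le hg ?_)
    exact Polynomial.natDegree_mul_le.trans (by omega)
  rw [Polynomial.natDegree_mul hb0 hy] at h1
  omega

variable [IsAlgClosed K]

theorem exists_decomposition {a b g : RingT K} {m i : ℕ} (hm : m ≠ 0) (ha : a.IsHomogeneous m)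
    (hb : b.IsHomogeneous m) (hab : IsRelPrime a b) (hg : g.IsHomogeneous i)
    (hi : 2 * m ≤ i + 1) : ∃ x y : RingT K, x.IsHomogeneous (i - m) ∧ y.IsHomogeneous (i - m) ∧
      g = a * x + b * y := by
  have hcop : IsCoprime (dehom a) (dehom b) := by
    rw [Polynomial.isCoprime_iff_aeval_ne_zero_of_isAlgClosed K K]
    intro y
    simp only [Polynomial.coe_aeval_eq_eval, eval_dehom]
    exact eval_ne_zero_of_isRelPrime ha hb hab fun h => by simpa using congr_fun h 1
  -- The forms do not both vanish at (1 : 0), so one of them keeps its full degree when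
  -- dehomogenized.
  have hlead : (dehom a).natDegree = m ∨ (dehom b).natDegree = m := by
    have := eval_ne_zero_of_isRelPrime ha hb hab (t := ![1, 0])
      fun h => by simpa using congr_fun h 0
    rw [← coeff_dehom_self ha, ← coeff_dehom_self hb] at this
    exact this.imp
      (fun h => le_antisymm (natDegree_dehom_le ha) (Polynomial.le_natDegree_of_ne_zero h))
      (fun h => le_antisymm (natDegree_dehom_le hb) (Polynomial.le_natDegree_of_ne_zero h))
  obtain ⟨x, y, hx, hy, hxy⟩ : ∃ x y : Polynomial K, x.natDegree ≤ i - m ∧ y.natDegree ≤ i - m ∧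
      dehom g = dehom a * x + dehom b * y := by
    rcases hlead with h | h
    · obtain ⟨x, y, hx, hy, hxy⟩ := exists_bezout_of_natDegree hm (natDegree_dehom_le hb) h
        hcop.symm (natDegree_dehom_le hg) hi
      exact ⟨y, x, hy, hx, by rw [hxy, add_comm]⟩
    · exact exists_bezout_of_natDegree hm (natDegree_dehom_le ha) h hcop (natDegree_dehom_le hg) hi
  refine ⟨x.homogenize (i - m), y.homogenize (i - m), Polynomial.isHomogeneous_homogenize _,
    Polynomial.isHomogeneous_homogenize _, ?_⟩
  have hdeg : m + (i - m) = i := by omega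
  refine dehom_injective_of_isHomogeneous hg ?_ ?_
  · conv => arg 2; rw [← hdeg]
    exact (ha.mul (Polynomial.isHomogeneous_homogenize _)).add
      (hb.mul (Polynomial.isHomogeneous_homogenize _))
  · rw [map_add, map_mul, map_mul, dehom_homogenize hx, dehom_homogenize hy, hxy]

theorem exists_isDT {a b : RingT K} {i j : ℕ} (hμ : μ ≠ 0) (ha : a.IsHomogeneous μ)
    (hb : b.IsHomogeneous μ) (hab : IsRelPrime a b) {G : RingTX K} (hG : IsBihomogeneous G i j)
    (hi : 2 * μ ≤ i + 1) : ∃ H, IsDT μ a b i j G H := by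
  choose x y hx hy hxy using fun m => exists_decomposition hμ ha hb hab (hG.2 m) hi
  have hbi (z : (Fin 3 →₀ ℕ) → RingT K) (hz : ∀ m, (z m).IsHomogeneous (i - μ)) :
      IsBihomogeneous (∑ m ∈ G.support, monomial m (z m)) (i - μ) j := by
    constructor
    · refine IsHomogeneous.sum _ _ _ fun m hm => isHomogeneous_monomial _ ?_
      by_contra h
      exact mem_support_iff.1 hm (hG.1.coeff_eq_zero h)
    · intro m
      rw [coeff_sum]
      refine IsHomogeneous.sum _ _ _ fun m' _ => ?_
      rw [coeff_monomial]
      split_ifs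
      · exact hz m'
      · exact isHomogeneous_zero _ _ _
  refine ⟨_, hi, hG, _, _, hbi x hx, hbi y hy, ?_, rfl⟩
  conv_lhs => rw [G.as_sum]
  rw [Finset.mul_sum, Finset.mul_sum, ← Finset.sum_add_distrib]
  refine Finset.sum_congr rfl fun m _ => ?_
  rw [C_mul_monomial, C_mul_monomial, ← map_add, ← hxy]

theorem IsSplitMuBasis.exists_isFamily (h : IsSplitMuBasis u d μ p q) {k : ℕ}
    (hk : k * μ ≤ d + 1) : ∃ F, IsFamily d μ k p q F := by
  classical
  have hstep (j : ℕ) (hj : j + 2 ≤ k) (G : RingTX K) (hG : IsBihomogeneous G (d - j * μ) j) :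
      ∃ H, IsDT μ (-p 1) (p 0) (d - j * μ) j G H := by
    refine exists_isDT h.ne_zero (h.homogeneous_left 1).neg (h.homogeneous_left 0)
      h.isRelPrime.symm.neg_left hG ?_
    have := (Nat.mul_le_mul_right μ hj).trans hk
    rw [add_mul] at this
    omega
  choose! D hD using hstep
  -- The shift by one starts the recursion at index 1; `F 0` is a junk value.
  let F : ℕ → RingTX K := fun n => Nat.rec (toForm q) (fun n G => D (n + 1) G) (n - 1)
  have hF1 : F 1 = toForm q := rfl
  have hFs (n : ℕ) : F (n + 2) = D (n + 1) (F (n + 1)) := rfl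
  have hbi (n : ℕ) (hn : n + 1 ≤ k - 1) :
      IsBihomogeneous (F (n + 1)) (d - (n + 1) * μ) (n + 1) := by
    induction n with
    | zero => rw [hF1, zero_add, one_mul]; exact toForm_isBihomogeneous h.homogeneous_right
    | succ n ih =>
      have := (hD (n + 1) (by omega) _ (ih (by omega))).isBihomogeneous
      rwa [Nat.sub_sub, ← Nat.succ_mul] at this
  refine ⟨F, hF1, fun j hj hjk => ?_⟩
  obtain ⟨n, rfl⟩ := Nat.exists_eq_add_of_le' hj
  rw [hFs]
  exact hD (n + 1) (by omega) _ (hbi n (by omega))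

end Decomposition

theorem IsSplitMuBasis.exists_resT_eq [IsAlgClosed K] (h : IsSplitMuBasis u d μ p q) {E : RingX K}
    (hE : IsImplicitEquation u E) (hEd : E.IsHomogeneous d) {k : ℕ} (hk : k * μ ≤ d + 1)
    {F : ℕ → RingTX K} (hF : IsFamily d μ k p q F) {j : ℕ} (hj : 1 ≤ j) (hjk : j ≤ k - 1) :
    ∃ c : K, c ≠ 0 ∧ resT (toForm p) (F j) μ (d - j * μ) = C c * E := by
  obtain ⟨hmem, -, hev⟩ := h.isFamily_spec hF hj hjk
  have hp : MemReesPiece u μ 1 (toForm p) :=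
    ⟨toForm_mem_reesIdeal h.left_mem, toForm_isBihomogeneous h.homogeneous_left⟩
  have hd : d ≠ 0 := by have := h.le; have := h.ne_zero; omega
  obtain ⟨e, he⟩ := hE.dvd_resT h.ne_zero hp hmem
  have hne : resT (toForm p) (F j) μ (d - j * μ) ≠ 0 := by
    intro h0
    -- If the resultant were zero, every point with X₀ ≠ 0 would carry a common zero of P and F_j,
    -- hence of P and Q, and so lie on C. Then E·X₀ would vanish identically.
    have hEX : E * X 0 ≠ 0 := mul_ne_zero hE.irreducible.ne_zero (X_ne_zero 0)
    apply hEX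
    apply MvPolynomial.funext
    intro x
    rw [map_mul, map_zero, eval_X]
    by_contra hx
    have h1 : eval x (resT (toForm p) (F j) μ (d - j * μ)) = 0 := by rw [h0, map_zero]
    rw [eval_resT_eq_zero_iff h.ne_zero hp.2.2 hmem.2.2] at h1
    obtain ⟨t, ht, h2, h3⟩ := h1
    refine hx (mul_eq_zero_of_left (h.eval_resT_eq_zero h.ne_zero hd h.homogeneous
      h.isUnit_of_dvd hE ((eval_resT_eq_zero_iff h.ne_zero hp.2.2
        (toForm_isBihomogeneous h.homogeneous_right).2 x).2
        ⟨t, ht, h2, hev t x (right_ne_zero_of_mul hx) h2 h3⟩)) _)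
  have hdeg := (resT_isHomogeneous hp.2.1 hmem.2.1 μ (d - j * μ)).totalDegree hne
  rw [he] at hne
  have he0 := right_ne_zero_of_mul hne
  rw [he, totalDegree_mul_of_isDomain hE.irreducible.ne_zero he0,
    hEd.totalDegree hE.irreducible.ne_zero] at hdeg
  have hjd : j * μ ≤ d := by
    have h1 : (j + 1) * μ ≤ k * μ := Nat.mul_le_mul_right μ (by omega)
    rw [add_mul] at h1
    have := h.ne_zero
    omega
  have hec := totalDegree_eq_zero_iff_eq_C.1 (show e.totalDegree = 0 by rw [mul_comm μ] at hdeg; omega)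
  refine ⟨coeff 0 e, fun h0 => he0 (by rw [hec, h0, C_0]), ?_⟩
  rw [he, ← hec, mul_comm]

end

/-! ### Bigraded components and minimal generators -/

section

/-- The component of degree `i` in `T` of an element of `K[T][X]`. -/
def compT (i : ℕ) (G : RingTX K) : RingTX K :=
  ∑ m ∈ G.support, monomial m (homogeneousComponent i (coeff m G))

lemma coeff_compT (i : ℕ) (G : RingTX K) (m : Fin 3 →₀ ℕ) :
    coeff m (compT i G) = homogeneousComponent i (coeff m G) := by
  rw [compT, coeff_sum, Finset.sum_eq_single m]
  · rw [coeff_monomial, if_pos rfl]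
  · intro b _ hb
    rw [coeff_monomial, if_neg hb]
  · intro hm
    rw [notMem_support_iff.1 hm, map_zero, map_zero, coeff_zero]

/-- The component of bidegree `(i, j)` of an element of `K[T][X]`. -/
def biComp (i j : ℕ) (G : RingTX K) : RingTX K := compT i (homogeneousComponent j G)

lemma coeff_biComp (i j : ℕ) (G : RingTX K) (m : Fin 3 →₀ ℕ) :
    coeff m (biComp i j G) = if m.degree = j then homogeneousComponent i (coeff m G) else 0 := by
  rw [biComp, coeff_compT, coeff_homogeneousComponent]
  split_ifs
  · rfl
  · exact map_zero _

lemma isBihomogeneous_biComp (i j : ℕ) (G : RingTX K) : IsBihomogeneous (biComp i j G) i j := by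
  constructor
  · intro m hm
    rw [coeff_biComp] at hm
    by_contra h
    rw [if_neg (by rwa [Finsupp.degree_eq_weight_one])] at hm
    exact hm rfl
  · intro m
    rw [coeff_biComp]
    split_ifs
    · exact homogeneousComponent_isHomogeneous _ _
    · exact isHomogeneous_zero _ _ _

lemma biComp_sum {ι : Type*} (i j : ℕ) (s : Finset ι) (f : ι → RingTX K) :
    biComp i j (∑ a ∈ s, f a) = ∑ a ∈ s, biComp i j (f a) := by
  ext1 m
  rw [coeff_biComp, coeff_sum, coeff_sum, map_sum]
  simp only [coeff_biComp]
  split_ifs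
  · rfl
  · exact Finset.sum_const_zero.symm

lemma biComp_eq_self {G : RingTX K} {i j : ℕ} (hG : IsBihomogeneous G i j) :
    biComp i j G = G := by
  ext1 m
  rw [coeff_biComp]
  split_ifs with h
  · exact homogeneousComponent_eq_self (hG.2 m)
  · exact (hG.1.coeff_eq_zero h).symm

lemma sum_biComp (G : RingTX K) : ∃ N, G = ∑ j ∈ Finset.range N, ∑ i ∈ Finset.range N,
    biComp i j G := by
  refine ⟨max (G.totalDegree + 1) (G.support.sup (fun m => (coeff m G).totalDegree) + 1), ?_⟩
  set N := max (G.totalDegree + 1) (G.support.sup (fun m => (coeff m G).totalDegree) + 1)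
  ext1 m
  by_cases hm : m ∈ G.support
  · simp only [coeff_sum, coeff_biComp]
    rw [Finset.sum_eq_single m.degree]
    · simp only [if_true]
      have hN : (coeff m G).totalDegree + 1 ≤ N := le_trans (Nat.add_le_add_right
        (Finset.le_sup (f := fun m => (coeff m G).totalDegree) hm) 1) (le_max_right _ _)
      conv_lhs => rw [← sum_homogeneousComponent (coeff m G)]
      refine Finset.sum_subset (Finset.range_subset_range.2 hN) fun l _ hl => ?_
      exact homogeneousComponent_eq_zero _ _ (by simpa using hl)
    · intro b _ hb
      exact Finset.sum_eq_zero fun _ _ => if_neg (Ne.symm hb)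
    · intro h
      exfalso
      apply h
      have h1 := le_totalDegree hm
      rw [Finset.mem_range]
      refine lt_of_lt_of_le (Nat.lt_succ_of_le ?_) (le_max_left _ _)
      exact h1
  · rw [notMem_support_iff.1 hm, coeff_sum]
    refine (Finset.sum_eq_zero fun j _ => ?_).symm
    rw [coeff_sum]
    refine Finset.sum_eq_zero fun i _ => ?_
    rw [coeff_biComp, notMem_support_iff.1 hm, map_zero, ite_self]

lemma compT_mul {G : RingTX K} {a : ℕ} (hG : ∀ m, (coeff m G).IsHomogeneous a) (i : ℕ)
    (c : RingTX K) : compT (i + a) (c * G) = compT i c * G := by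
  ext1 m
  rw [coeff_compT, coeff_mul, coeff_mul, map_sum]
  refine Finset.sum_congr rfl fun x _ => ?_
  rw [homogeneousComponent_mul_of_isHomogeneous (hG _), coeff_compT]

lemma compT_mul_of_lt {G : RingTX K} {a i : ℕ} (hG : ∀ m, (coeff m G).IsHomogeneous a) (hi : i < a)
    (c : RingTX K) : compT i (c * G) = 0 := by
  ext1 m
  rw [coeff_compT, coeff_mul, map_sum, coeff_zero]
  exact Finset.sum_eq_zero fun x _ => homogeneousComponent_mul_of_lt (hG _) hi _

lemma compT_zero (i : ℕ) : compT i (0 : RingTX K) = 0 := by simp [compT]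

lemma biComp_mul {G : RingTX K} {a b : ℕ} (hG : IsBihomogeneous G a b) (i j : ℕ) (c : RingTX K) :
    biComp (i + a) (j + b) (c * G) = biComp i j c * G := by
  rw [biComp, homogeneousComponent_mul_of_isHomogeneous hG.1, compT_mul hG.2, biComp]

lemma biComp_mul_eq_zero {G : RingTX K} {a b i j : ℕ} (hG : IsBihomogeneous G a b)
    (hij : ¬ (a ≤ i ∧ b ≤ j)) (c : RingTX K) : biComp i j (c * G) = 0 := by
  rw [biComp]
  by_cases hb : b ≤ j
  · obtain ⟨l, rfl⟩ := Nat.exists_eq_add_of_le' hb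
    rw [homogeneousComponent_mul_of_isHomogeneous hG.1, compT_mul_of_lt hG.2 (by omega)]
  · rw [homogeneousComponent_mul_of_lt hG.1 (by omega), compT_zero]

lemma biComp_zero_zero (G : RingTX K) : biComp 0 0 G = C (C (coeff 0 (coeff 0 G))) := by
  ext1 m
  rw [coeff_biComp, coeff_C, homogeneousComponent_zero]
  by_cases h : m = 0
  · simp [h]
  · rw [if_neg ((Finsupp.degree_eq_zero_iff m).not.2 h), if_neg (Ne.symm h)]

/-- The ideal generated by the bihomogeneous elements of `J` whose bidegree is smaller than
`(i, j)`. -/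
def lowerIdeal (J : Ideal (RingTX K)) (i j : ℕ) : Ideal (RingTX K) :=
  Ideal.span {G | G ∈ J ∧ ∃ a b, a ≤ i ∧ b ≤ j ∧ (a, b) ≠ (i, j) ∧ IsBihomogeneous G a b}

/-- The component is G times the part of c of the complementary bidegree. That part is a scalar when
G itself has bidegree (i, j); otherwise G has smaller bidegree, or the component is zero. -/
lemma biComp_mul_mem {J : Ideal (RingTX K)} {G : RingTX K} {a b : ℕ} (hGJ : G ∈ J)
    (hG : IsBihomogeneous G a b) (i j : ℕ) (c : RingTX K) :
    biComp i j (c * G) ∈ Ideal.span {G} ∧ (biComp i j (c * G) ∈ lowerIdeal J i j ∨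
      (IsBihomogeneous G i j ∧ ∃ γ : K, biComp i j (c * G) = C (C γ) * G)) := by
  by_cases hij : a ≤ i ∧ b ≤ j
  · obtain ⟨l, rfl⟩ := Nat.exists_eq_add_of_le' hij.1
    obtain ⟨n, rfl⟩ := Nat.exists_eq_add_of_le' hij.2
    rw [biComp_mul hG]
    refine ⟨Ideal.mul_mem_left _ _ (Ideal.mem_span_singleton_self G), ?_⟩
    by_cases h : l = 0 ∧ n = 0
    · obtain ⟨rfl, rfl⟩ := h
      rw [zero_add, zero_add]
      exact .inr ⟨hG, _, by rw [biComp_zero_zero]⟩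
    · refine .inl (Ideal.mul_mem_left _ _ (Ideal.subset_span ⟨hGJ, a, b, hij.1, hij.2, ?_, hG⟩))
      intro h'
      rw [Prod.mk.injEq] at h'
      omega
  · rw [biComp_mul_eq_zero hG hij]
    exact ⟨zero_mem _, .inl (zero_mem _)⟩

theorem exists_finset_bihomogeneous_span_eq {J : Ideal (RingTX K)}
    (hJ : ∀ G ∈ J, ∀ i j, biComp i j G ∈ J) :
    ∃ S : Finset (RingTX K), (∀ s ∈ S, ∃ i j, IsBihomogeneous s i j) ∧
      Ideal.span (S : Set (RingTX K)) = J := by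
  classical
  obtain ⟨B, hB⟩ := (isNoetherianRing_iff_ideal_fg _).1 inferInstance J
  choose N hN using fun G : RingTX K => sum_biComp G
  refine ⟨B.biUnion fun G => (Finset.range (N G)).biUnion fun j =>
    (Finset.range (N G)).image fun i => biComp i j G, ?_, le_antisymm ?_ ?_⟩
  · intro s hs
    simp only [Finset.mem_biUnion, Finset.mem_image] at hs
    obtain ⟨G, -, j, -, i, -, rfl⟩ := hs
    exact ⟨i, j, isBihomogeneous_biComp i j G⟩
  · rw [Ideal.span_le]
    intro s hs
    simp only [Finset.mem_coe, Finset.mem_biUnion, Finset.mem_image] at hs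
    obtain ⟨G, hG, j, -, i, -, rfl⟩ := hs
    exact hJ G (hB ▸ Ideal.subset_span hG) i j
  · rw [← hB, Ideal.span_le]
    intro G hG
    rw [SetLike.mem_coe, hN G]
    refine sum_mem fun j hj => sum_mem fun i hi => Ideal.subset_span ?_
    simp only [Finset.mem_coe, Finset.mem_biUnion, Finset.mem_image]
    exact ⟨G, hG, j, hj, i, hi, rfl⟩

/-- Among the finite bihomogeneous generating sets containing S₀, one of least cardinality works.
Elements outside S₀ are needed by minimality; those of S₀ by a graded Nakayama argument. -/
theorem exists_isMinimalGenerators {J : Ideal (RingTX K)}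
    (hJ : ∀ G ∈ J, ∀ i j, biComp i j G ∈ J) {S₀ : Set (RingTX K)} (hfin : S₀.Finite)
    (hS₀J : S₀ ⊆ J) (hS₀ : ∀ s ∈ S₀, ∃ i j, IsBihomogeneous s i j ∧
      (∀ t ∈ S₀, IsBihomogeneous t i j → t = s) ∧ s ∉ lowerIdeal J i j) :
    ∃ S, IsMinimalGenerators J S ∧ S₀ ⊆ S := by
  classical
  obtain ⟨S₁, hS₁, hspan⟩ := exists_finset_bihomogeneous_span_eq hJ
  obtain ⟨S, ⟨hS₀S, hbi, hSJ⟩, hmin⟩ := (measure Finset.card).wf.has_min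
    {S : Finset (RingTX K) | S₀ ⊆ S ∧ (∀ s ∈ S, ∃ i j, IsBihomogeneous s i j) ∧
      Ideal.span (S : Set (RingTX K)) = J}
    ⟨hfin.toFinset ∪ S₁, by simp, by
      intro s hs
      rcases Finset.mem_union.1 hs with hs | hs
      · obtain ⟨i, j, h, -⟩ := hS₀ s (hfin.mem_toFinset.1 hs)
        exact ⟨i, j, h⟩
      · exact hS₁ s hs, by
      rw [Finset.coe_union, Ideal.span_union, hspan, sup_eq_right, Ideal.span_le]
      simpa using hS₀J⟩
  have hmem (s) (hs : s ∈ S) : s ∈ J := hSJ ▸ Ideal.subset_span hs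
  have hnot (t) (ht : t ∈ S) (ht₀ : t ∉ S₀) : t ∉ Ideal.span ((S : Set (RingTX K)) \ {t}) := by
    intro h
    refine hmin (S.erase t) ⟨?_, fun s hs => hbi s (Finset.mem_of_mem_erase hs), ?_⟩
      (Finset.card_erase_lt_of_mem ht)
    · rw [Finset.coe_erase]
      exact fun s hs => ⟨hS₀S hs, fun h => ht₀ (h ▸ hs)⟩
    · rw [Finset.coe_erase]
      refine le_antisymm (hSJ ▸ Ideal.span_mono Set.sdiff_subset) ?_
      rw [← hSJ, Ideal.span_le]
      intro s hs
      by_cases hst : s = t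
      · exact hst ▸ h
      · exact Ideal.subset_span ⟨hs, hst⟩
  refine ⟨S, ⟨S.finite_toSet, hbi, hSJ, fun s hs hspan => ?_⟩, hS₀S⟩
  by_cases hs₀ : s ∈ S₀
  · obtain ⟨i, j, hsij, huniq, hlow⟩ := hS₀ s hs₀
    rw [← Finset.coe_erase] at hspan
    obtain ⟨c, -, hc⟩ := Submodule.mem_span_finset.1 hspan
    simp only [smul_eq_mul] at hc
    have hsum := biComp_eq_self hsij
    rw [← hc, biComp_sum, hc] at hsum
    have hterm (t) (ht : t ∈ S.erase s) : biComp i j (c t * t) ∈ Ideal.span {t} ∧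
        (biComp i j (c t * t) ∈ lowerIdeal J i j ∨
          (IsBihomogeneous t i j ∧ ∃ γ : K, biComp i j (c t * t) = C (C γ) * t)) := by
      obtain ⟨a, b, hab⟩ := hbi t (Finset.mem_of_mem_erase ht)
      exact biComp_mul_mem (hmem t (Finset.mem_of_mem_erase ht)) hab i j (c t)
    apply hlow
    rw [← hsum]
    refine sum_mem fun t ht => ?_
    rcases (hterm t ht).2 with h | ⟨htij, γ, hγ⟩
    · exact h
    have htS := Finset.mem_of_mem_erase ht
    by_cases hγ0 : γ = 0
    · rw [hγ, hγ0, C_0, C_0, zero_mul]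
      exact zero_mem _
    · exfalso
      have hts : t ≠ s := Finset.ne_of_mem_erase ht
      -- Here `t`, of the same bidegree as `s`, occurs with nonzero scalar γ. Then it lies outside
      -- S₀, and solving for it expresses it through `s` and the other generators.
      refine hnot t htS (fun ht₀ => hts (huniq t ht₀ htij)) ?_
      have hrest : C (C γ) * t ∈ Ideal.span ((S : Set (RingTX K)) \ {t}) := by
        rw [← hγ, eq_sub_of_add_eq ((Finset.add_sum_erase _ _ ht).trans hsum)]
        refine sub_mem (Ideal.subset_span ⟨hs, hts.symm⟩) (sum_mem fun t' ht' => ?_)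
        refine Ideal.span_mono ?_ (hterm t' (Finset.mem_of_mem_erase ht')).1
        rw [Set.singleton_subset_iff]
        exact ⟨Finset.mem_of_mem_erase (Finset.mem_of_mem_erase ht'), Finset.ne_of_mem_erase ht'⟩
      have := Ideal.mul_mem_left _ (C (C γ⁻¹)) hrest
      rwa [← mul_assoc, ← C_mul, ← C_mul, inv_mul_cancel₀ hγ0, C_1, C_1, one_mul] at this
  · exact hnot s hs hs₀ hspan

variable {u p q : Fin 3 → RingT K} {d μ : ℕ}

/-- All uᵢ have degree d, so on forms of degree j in X the T-component i corresponds, after X ↦ u,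
to the component of degree i + dj. -/
theorem biComp_mem_reesIdeal (hu : ∀ i, (u i).IsHomogeneous d) {G : RingTX K}
    (hG : G ∈ reesIdeal u) (i j : ℕ) : biComp i j G ∈ reesIdeal u := by
  rw [mem_reesIdeal_iff_of_isHomogeneous (isBihomogeneous_biComp i j G).1]
  have h1 := congrArg (homogeneousComponent (i + d * j)) (mem_reesIdeal_iff.1 hG j)
  have hH := homogeneousComponent_isHomogeneous j G
  rw [biComp]
  set H := homogeneousComponent j G
  rw [map_zero] at h1
  rw [← h1]
  conv_rhs => rw [H.as_sum]
  rw [compT, map_sum, map_sum, map_sum]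
  refine Finset.sum_congr rfl fun m hm => ?_
  have hm' : m.degree = j := by
    by_contra h
    exact mem_support_iff.1 hm (hH.coeff_eq_zero h)
  have hprod : (m.prod fun i k => u i ^ k).IsHomogeneous (d * j) := by
    rw [← hm', Finsupp.degree_apply, Finset.mul_sum]
    exact IsHomogeneous.prod _ _ _ fun l _ => (hu l).pow (m l)
  rw [aeval_monomial, aeval_monomial, Algebra.algebraMap_self, RingHom.id_apply, RingHom.id_apply,
    homogeneousComponent_mul_of_isHomogeneous hprod]

lemma IsBihomogeneous.unique {G : RingTX K} (hG : G ≠ 0) {i j i' j' : ℕ}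
    (h : IsBihomogeneous G i j) (h' : IsBihomogeneous G i' j') : i = i' ∧ j = j' := by
  obtain ⟨m, hm⟩ := ne_zero_iff.1 hG
  exact ⟨(h.2 m).inj_right (h'.2 m) hm, h.1.inj_right h'.1 hG⟩

lemma inclX_isBihomogeneous {G : RingX K} {j : ℕ} (hG : G.IsHomogeneous j) :
    IsBihomogeneous (inclX G) 0 j :=
  ⟨IsHomogeneous.map hG _, fun m => by rw [inclX, coeff_map]; exact isHomogeneous_C _ _⟩

lemma aeval_inclX (G : RingX K) : aeval u (inclX G) = aeval u G := by
  have : (aeval u : RingTX K →ₐ[RingT K] RingT K).toRingHom.comp inclX =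
      (aeval u : RingX K →ₐ[K] RingT K).toRingHom := by
    ext i <;> simp [inclX]
  exact congr($this G)

lemma exists_eq_inclX {G : RingTX K} {j : ℕ} (hG : IsBihomogeneous G 0 j) :
    ∃ H : RingX K, H.IsHomogeneous j ∧ G = inclX H := by
  refine ⟨map constantCoeff G, IsHomogeneous.map hG.1 _, ?_⟩
  ext1 m
  rw [inclX, coeff_map, coeff_map, constantCoeff_eq]
  exact totalDegree_eq_zero_iff_eq_C.1 (Nat.le_zero.1 (hG.2 m).totalDegree_le)

/-- A form of degree less than d in X alone that vanishes on C is a multiple of E, hence zero. -/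
theorem IsImplicitEquation.inclX_notMem_lowerIdeal [IsAlgClosed K] {E : RingX K}
    (hE : IsImplicitEquation u E) (hEd : E.IsHomogeneous d) :
    inclX E ∉ lowerIdeal (reesIdeal u) 0 d := by
  have hle : lowerIdeal (reesIdeal u) 0 d ≤ ⊥ := by
    rw [lowerIdeal, Ideal.span_le]
    rintro G ⟨hG, a, b, ha, hb, hne, hab⟩
    obtain rfl : a = 0 := by omega
    obtain ⟨H, hH, rfl⟩ := exists_eq_inclX hab
    rw [mem_reesIdeal_iff_of_isHomogeneous hab.1, aeval_inclX] at hG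
    obtain ⟨e, rfl⟩ := hE.dvd_of_aeval_eq_zero hH hG
    by_cases h0 : E * e = 0
    · simp [h0]
    · exfalso
      have := totalDegree_mul_of_isDomain (left_ne_zero_of_mul h0) (right_ne_zero_of_mul h0)
      rw [hH.totalDegree h0, hEd.totalDegree hE.irreducible.ne_zero] at this
      exact hne (by rw [Prod.mk.injEq]; omega)
  intro h
  have h0 := hle h
  rw [Ideal.mem_bot] at h0
  exact hE.irreducible.ne_zero (map_injective _ (C_injective _ _) (h0.trans (map_zero _).symm))

namespace IsSplitMuBasis

lemma toForm_left_ne_zero (h : IsSplitMuBasis u d μ p q) : toForm p ≠ 0 := by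
  intro h0
  apply h.one_ne_zero
  have := coeff_toForm p (Finsupp.single 1 1)
  rw [h0, Fin.sum_univ_three] at this
  simpa [Finsupp.single_left_inj] using this.symm

/-- Below bidegree (μ, 1) every element of 𝒦 has a + μb < 2μ ≤ d, so it is a multiple of P, and
being of smaller bidegree it is zero. -/
theorem left_notMem_lowerIdeal (h : IsSplitMuBasis u d μ p q) :
    toForm p ∉ lowerIdeal (reesIdeal u) μ 1 := by
  have hle : lowerIdeal (reesIdeal u) μ 1 ≤ ⊥ := by
    rw [lowerIdeal, Ideal.span_le]
    rintro G ⟨hG, a, b, ha, hb, hne, hab⟩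
    have hne' : ¬ (a = μ ∧ b = 1) := by simpa using hne
    have hlt : a + μ * b < d := by
      have := h.le
      have := h.ne_zero
      interval_cases b <;> omega
    obtain ⟨e, rfl⟩ := h.dvd_of_lt ⟨hG, hab⟩ hlt
    by_contra h0
    change toForm p * e ≠ 0 at h0
    have he0 := right_ne_zero_of_mul h0
    have h1 := totalDegree_mul_of_isDomain h.toForm_left_ne_zero he0
    rw [hab.1.totalDegree h0, (toForm_isHomogeneous p).totalDegree h.toForm_left_ne_zero] at h1
    have heC := totalDegree_eq_zero_iff_eq_C.1 (show e.totalDegree = 0 by omega)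
    set c := coeff 0 e
    have hc0 : c ≠ 0 := fun hc => he0 (by rw [heC, hc, C_0])
    have h2 : coeff (Finsupp.single 1 1) (toForm p * e) = p 1 * c := by
      rw [heC, mul_comm, coeff_C_mul, coeff_toForm, Fin.sum_univ_three, mul_comm]
      simp [Finsupp.single_left_inj]
    have h3 := hab.2 (Finsupp.single 1 1)
    rw [h2] at h3
    have h4 := totalDegree_mul_of_isDomain h.one_ne_zero hc0
    rw [h3.totalDegree (mul_ne_zero h.one_ne_zero hc0),
      (h.homogeneous_left 1).totalDegree h.one_ne_zero] at h4
    omega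
  exact fun hmem => h.toForm_left_ne_zero (hle hmem)

/-- Bidegrees strictly below (d - jμ, j) satisfy a + μb < d, so θ kills the whole lower ideal, but
not F_j. -/
theorem family_notMem_lowerIdeal (h : IsSplitMuBasis u d μ p q) {k : ℕ} {F : ℕ → RingTX K}
    (hF : IsFamily d μ k p q F) {j : ℕ} (hj : 1 ≤ j) (hjk : j ≤ k - 1) (hjd : j * μ ≤ d) :
    F j ∉ lowerIdeal (reesIdeal u) (d - j * μ) j := by
  have hle : lowerIdeal (reesIdeal u) (d - j * μ) j ≤ RingHom.ker (theta p) := by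
    rw [lowerIdeal, Ideal.span_le]
    rintro G ⟨hG, a, b, ha, hb, hne, hab⟩
    refine h.theta_eq_zero_of_lt ⟨hG, hab⟩ ?_
    have hne' : ¬ (a = d - j * μ ∧ b = j) := by simpa using hne
    rcases hb.lt_or_eq with hlt | rfl
    · have : μ * b < μ * j := Nat.mul_lt_mul_of_pos_left hlt (Nat.pos_of_ne_zero h.ne_zero)
      rw [mul_comm μ j] at this
      omega
    · rw [mul_comm μ b]
      omega
  intro hmem
  have h0 : theta p (F j) = 0 := hle hmem
  rw [(h.isFamily_spec hF hj hjk).2.1] at h0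
  exact h.theta_right_ne_zero h0

/-- The bidegrees (0, d), (μ, 1) and (d - jμ, j) are pairwise distinct: `hkd` separates F_j from E,
and `hμd` separates F₁ from P. -/
theorem ncard_and_exists_isMinimalGenerators [IsAlgClosed K] (h : IsSplitMuBasis u d μ p q)
    (hμd : μ < d - μ) {E : RingX K} (hE : IsImplicitEquation u E) (hEd : E.IsHomogeneous d)
    {k : ℕ} (hk : 2 ≤ k) (hkd : (k - 1) * μ < d) {F : ℕ → RingTX K}
    (hF : IsFamily d μ k p q F) :
    ({inclX E, toForm p} ∪ F '' Set.Icc 1 (k - 1)).ncard = k + 1 ∧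
      ∃ S, IsMinimalGenerators (reesIdeal u) S ∧
        {inclX E, toForm p} ∪ F '' Set.Icc 1 (k - 1) ⊆ S := by
  have hE0 : inclX E ≠ 0 := fun h0 =>
    hE.irreducible.ne_zero (map_injective _ (C_injective _ _) (h0.trans (map_zero _).symm))
  have hEb := inclX_isBihomogeneous hEd
  have hpb := toForm_isBihomogeneous h.homogeneous_left
  have hjd {j : ℕ} (hj : j ∈ Set.Icc 1 (k - 1)) : j * μ < d :=
    (Nat.mul_le_mul_right μ hj.2).trans_lt hkd
  have hFb {j : ℕ} (hj : j ∈ Set.Icc 1 (k - 1)) := (h.isFamily_spec hF hj.1 hj.2).1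
  have hF0 {j : ℕ} (hj : j ∈ Set.Icc 1 (k - 1)) : F j ≠ 0 := fun h0 =>
    h.family_notMem_lowerIdeal hF hj.1 hj.2 (hjd hj).le (h0 ▸ zero_mem _)
  have hμ := h.ne_zero
  have hEp : inclX E ≠ toForm p := fun he =>
    hμ (hpb.unique h.toForm_left_ne_zero (he ▸ hEb)).1
  have hEF {j : ℕ} (hj : j ∈ Set.Icc 1 (k - 1)) : ¬ IsBihomogeneous (F j) 0 d := fun he => by
    have := ((hFb hj).2.unique (hF0 hj) he).1
    have := hjd hj
    omega
  have hpF {j : ℕ} (hj : j ∈ Set.Icc 1 (k - 1)) : ¬ IsBihomogeneous (F j) μ 1 := fun he => by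
    have := (hFb hj).2.unique (hF0 hj) he
    obtain ⟨h1, rfl⟩ := this
    omega
  have hinj : Set.InjOn F (Set.Icc 1 (k - 1)) := fun j hj l hl he =>
    ((hFb hj).2.unique (hF0 hj) (he ▸ (hFb hl).2)).2
  constructor
  · rw [Set.ncard_union_eq, Set.ncard_pair hEp, hinj.ncard_image]
    · rw [Set.ncard_eq_toFinset_card']
      simp
      omega
    · rw [Set.disjoint_left]
      rintro _ (rfl | rfl) ⟨j, hj, he⟩
      · exact hEF hj (he ▸ hEb)
      · exact hpF hj (he ▸ hpb)
  · refine exists_isMinimalGenerators (fun G hG i j => biComp_mem_reesIdeal h.homogeneous hG i j)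
      ((Set.toFinite _).union ((Set.finite_Icc _ _).image F)) ?_ ?_
    · rintro _ ((rfl | rfl) | ⟨j, hj, rfl⟩)
      · rw [SetLike.mem_coe, mem_reesIdeal_iff_of_isHomogeneous hEb.1, aeval_inclX]
        exact hE.aeval_eq_zero h.homogeneous (by omega)
      · exact toForm_mem_reesIdeal h.left_mem
      · exact (hFb hj).1
    · rintro _ ((rfl | rfl) | ⟨j, hj, rfl⟩)
      · refine ⟨0, d, hEb, ?_, hE.inclX_notMem_lowerIdeal hEd⟩
        rintro _ ((rfl | rfl) | ⟨l, hl, rfl⟩) ht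
        · rfl
        · exact absurd (hpb.unique h.toForm_left_ne_zero ht).1 hμ
        · exact absurd ht (hEF hl)
      · refine ⟨μ, 1, hpb, ?_, h.left_notMem_lowerIdeal⟩
        rintro _ ((rfl | rfl) | ⟨l, hl, rfl⟩) ht
        · exact absurd (hEb.unique hE0 ht).1.symm hμ
        · rfl
        · exact absurd ht (hpF hl)
      · refine ⟨_, j, (hFb hj).2, ?_, h.family_notMem_lowerIdeal hF hj.1 hj.2 (hjd hj).le⟩
        rintro _ ((rfl | rfl) | ⟨l, hl, rfl⟩) ht
        · have := (hEb.unique hE0 ht).1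
          have := hjd hj
          omega
        · have := hpb.unique h.toForm_left_ne_zero ht
          obtain ⟨h1, rfl⟩ := this
          omega
        · rw [((hFb hl).2.unique (hF0 hl) ht).2]

end IsSplitMuBasis

end

end

end ReesCurve

/-! ### The main theorem -/

theorem mainTheorem4 {K : Type*} [Field K] [IsAlgClosed K]
    (d μ k : ℕ) (r : ℤ)
    -- the parametrization
    (u : Fin 3 → ReesCurve.RingT K) (hu : ∀ i, (u i).IsHomogeneous d)
    (hgcd : ∀ f : ReesCurve.RingT K, (∀ i, f ∣ u i) → IsUnit f)
    (hproper : ReesCurve.IsProper u)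
    -- the implicit equation
    (E : ReesCurve.RingX K) (hE : ReesCurve.IsImplicitEquation u E)
    -- the `μ`-basis
    (p q : Fin 3 → ReesCurve.RingT K) (hpq : ReesCurve.IsMuBasis u d μ p q)
    -- `μ < d - μ` and `d = kμ + r`
    (hμd : μ < d - μ)
    (hd : (d : ℤ) = k * μ + r)
    (hr : (-1 ≤ r ∧ r < (μ : ℤ) - 1) ∨ (μ = 1 ∧ r = 0))
    -- `(0 : 0 : 1)` is a very singular point
    (hvs : (μ : ℕ∞) < ReesCurve.multAt E ![0, 0, 1]) :
    -- the form of `p` is `p¹ X₀ - p⁰ X₁`, with `p¹ = p 0`, `p⁰ = - p 1`; the family exists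
    p 2 = 0 ∧
    (∃ F, ReesCurve.IsFamily d μ k p q F) ∧
    -- elements of low degree
    (∀ (i j : ℕ) (G : ReesCurve.RingTX K), ReesCurve.MemReesPiece u i j G →
      i + μ * j < d → ReesCurve.toForm p ∣ G) ∧
    -- for every choice of the family
    (∀ F, ReesCurve.IsFamily d μ k p q F →
      (∀ j, 1 ≤ j → j ≤ k - 1 →
        ReesCurve.MemReesPiece u (d - j * μ) j (F j) ∧
        ¬ ReesCurve.toForm p ∣ F j ∧ F j ≠ 0) ∧
      (∀ j, 1 ≤ j → j ≤ k - 1 → ∃ c : K, c ≠ 0 ∧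
        ReesCurve.resT (ReesCurve.toForm p) (F j) μ (d - j * μ) = MvPolynomial.C c * E) ∧
      ((μ = 1 → k = d) →
        ({ReesCurve.inclX E, ReesCurve.toForm p} ∪ F '' Set.Icc 1 (k - 1)).ncard = k + 1 ∧
        ∃ S, ReesCurve.IsMinimalGenerators (ReesCurve.reesIdeal u) S ∧
          {ReesCurve.inclX E, ReesCurve.toForm p} ∪ F '' Set.Icc 1 (k - 1) ⊆ S)) := by

  have hμ : μ ≠ 0 := by
    rintro rfl
    omega
  obtain ⟨hp2, hEd, -⟩ := hpq.left_two_eq_zero hμ hu hgcd hproper hE hvs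
  have h : ReesCurve.IsSplitMuBasis u d μ p q := ⟨hpq, hu, hgcd, hμ, hp2⟩
  -- This is r ≥ -1. It makes F_{k-2} of T-degree at least 2μ - 1, so that 𝒟_T still applies to it.
  have hk : k * μ ≤ d + 1 := by
    zify
    rcases hr with hr | hr <;> omega
  refine ⟨hp2, h.exists_isFamily hk, fun i j G hG hlt => h.dvd_of_lt hG hlt,
    fun F hF => ⟨fun j hj hjk => ?_, fun j hj hjk => h.exists_resT_eq hE hEd hk hF hj hjk,
      fun hμk => ?_⟩⟩
  · obtain ⟨hmem, hθ, -⟩ := h.isFamily_spec hF hj hjk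
    have h0 : ReesCurve.theta p (F j) ≠ 0 := hθ ▸ h.theta_right_ne_zero
    refine ⟨hmem, ?_, fun hF0 => h0 (hF0 ▸ map_zero _)⟩
    rintro ⟨e, he⟩
    rw [he, map_mul, h.theta_left, zero_mul] at h0
    exact h0 rfl
  · have hk2 : 2 ≤ k := by
      by_contra! hlt
      interval_cases k <;> push_cast at hd <;> omega
    refine h.ncard_and_exists_isMinimalGenerators hμd hE hEd hk2 ?_ hF
    -- What remains is (k - 1)μ < d, that is r > -μ. It follows from r ≥ -1 if μ ≥ 2; if μ = 1 it
    -- needs k = d, since for k = d + 1 the last F has bidegree (0, d), as E does.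
    by_cases h1 : μ = 1
    · rw [hμk h1, h1]
      omega
    · obtain ⟨l, rfl⟩ := Nat.exists_eq_add_of_le' hk2
      rw [show l + 2 - 1 = l + 1 by omega]
      zify
      push_cast at hd
      have h2 : ((l : ℤ) + 2) * μ = (l + 1) * μ + μ := by ring
      omega
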